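/- Let $\mathbb R^{4,1}$ be $\mathbb R^5$ with the form $x_1y_1+x_2y_2+x_3y_3+x_4y_4-x_5y_5$, let $H^4=\{x\in\mathbb R^{4,1}: x\cdot x=-1,\ x_5>0\}$ be hyperbolic 4-space with base point $e_5$, and let $\mathrm{SO}^+(4,1)$ be the group of real $5\times5$ matrices of determinant $1$ that preserve the form and map $H^4$ to itself. Let $J=\mathrm{diag}(1,-1)$ and represent $\mathrm{Spin}^+(4,1)$ by the group $\mathrm{SU}(1,1;\mathbb H)=\{A\in M_2(\mathbb H): A^*JA=J\}$, with the double covering epimorphism $\eta:\mathrm{SU}(1,1;\mathbb H)\to\mathrm{SO}^+(4,1)$ given by the action $X\mapsto AXA^*$ on the Hermitian matrices $X=\begin{pmatrix} t& q\\ \bar q& t\end{pmatrix}$ ($t\in\mathbb R$, $q\in\mathbb H$), which are identified with $\mathbb R^{4,1}$ by $q=x_1+x_2\mathbf i+x_3\mathbf j+x_4\mathbf k$ and $t=x_5$. Let $\mathcal C$ be the regular hyperbolic 120-cell in $H^4$ with center $e_5$ and dihedral angle $2\pi/5$, placed so that the directions from $e_5$ to the centers of its 120 sides are the unit vectors of $\mathbb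 R^4$ obtained from $\frac12(2,0,0,0)$, $\frac12(1,1,1,1)$ and $\frac12(0,1,\tau,\tau^{-1})$, $\tau=(1+\sqrt5)/2$, by even permutations of the coordinates and arbitrary changes of signs. Let $\Gamma\subset\mathrm{SO}^+(4,1)$ be the group generated by the 120 hyperbolic translations, with axes through $e_5$, that carry a side of $\mathcal C$ to the opposite side (the translation length is $2r$, where $r$ is the inradius of $\mathcal C$, $\cosh r=\tau^2$). The Davis hyperbolic 4-manifold is $M=\Gamma\backslash H^4$. An orientation-preserving isometry of $M$ is a bijection $M\to M$ that is locally of the form $\Gamma x\mapsto\Gamma gx$ with $g\in\mathrm{SO}^+(4,1)$. A spin structure on $M$ is given by a subgroup $\hat\Gamma$ of $\mathrm{Spin}^+(4,1)$ that $\eta$ maps isomorphically onto $\Gamma$; its total space is $\hat\Gamma\backslash\mathrm{Spin}^+(4,1)$, with projection $\hat\Gamma\hat g\mapsto\Gamma\eta(\hat g)e_5$ to $M$. A symmetry of the spin structure is a map $\hat\Gamma\hat g\mapsto\hat\Gamma\hat f\hat g$ of the total space, where $\hat f$ is an element of the normalizer of $\hat\Gamma$ in $\mathrm{Spin}^+(4,1)$.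 The spin structure is fully symmetric if every orientation-preserving isometry of $M$ lifts to a symmetry of the spin structure. **Theorem 3.2.** The Davis hyperbolic 4-manifold $M$ has a unique fully symmetric spin structure; that is, there is exactly one subgroup $\hat\Gamma$ of $\mathrm{Spin}^+(4,1)$ that $\eta$ maps isomorphically onto $\Gamma$ and whose spin structure $\hat\Gamma\backslash\mathrm{Spin}^+(4,1)$ is fully symmetric. -/

import Mathlib

open scoped Matrix Quaternion Topology

noncomputable section

namespace Davis

/-! ### Hyperbolic 4-space and its orientation-preserving isometries -/

/-- The matrix `diag(1, 1, 1, 1, -1)` of the Lorentzian form on `ℝ^{4,1}`. -/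
def lorentzJ : Matrix (Fin 5) (Fin 5) ℝ := Matrix.diagonal ![1, 1, 1, 1, -1]

/-- The Lorentzian inner product `x₁y₁ + x₂y₂ + x₃y₃ + x₄y₄ - x₅y₅`. -/
def lorentz (x y : Fin 5 → ℝ) : ℝ := x ⬝ᵥ (lorentzJ *ᵥ y)

lemma lorentz_eq (x y : Fin 5 → ℝ) :
    lorentz x y = x 0 * y 0 + x 1 * y 1 + x 2 * y 2 + x 3 * y 3 - x 4 * y 4 := by
  simp only [lorentz, lorentzJ, Matrix.mulVec_diagonal, dotProduct, Fin.sum_univ_five]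
  simp [Matrix.cons_val_four]
  ring

/-- The hyperboloid model of hyperbolic 4-space. -/
def H4 : Set (Fin 5 → ℝ) := {x | lorentz x x = -1 ∧ 0 < x 4}

lemma lorentz_mulVec (g : Matrix (Fin 5) (Fin 5) ℝ) (hg : gᵀ * lorentzJ * g = lorentzJ)
    (x y : Fin 5 → ℝ) : lorentz (g *ᵥ x) (g *ᵥ y) = lorentz x y := by
  unfold lorentz
  rw [← Matrix.vecMul_transpose, ← Matrix.dotProduct_mulVec, Matrix.mulVec_mulVec,
    Matrix.mulVec_mulVec, hg]

lemma transpose_mul_of_lorentz (g : Matrix (Fin 5) (Fin 5) ℝ)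
    (hg : ∀ x y, lorentz (g *ᵥ x) (g *ᵥ y) = lorentz x y) : gᵀ * lorentzJ * g = lorentzJ := by
  have key : ∀ x y : Fin 5 → ℝ, x ⬝ᵥ ((gᵀ * lorentzJ * g) *ᵥ y) = x ⬝ᵥ (lorentzJ *ᵥ y) := by
    intro x y
    rw [← Matrix.mulVec_mulVec, ← Matrix.mulVec_mulVec, Matrix.dotProduct_mulVec,
      Matrix.vecMul_transpose]
    exact hg x y
  ext i j
  simpa using key (Pi.single i 1) (Pi.single j 1)

/-- The group `SO⁺(4,1)` of positive Lorentzian matrices of determinant one. -/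
def SOPlus : Subgroup (GL (Fin 5) ℝ) where
  carrier := {g | g.valᵀ * lorentzJ * g.val = lorentzJ ∧ g.val.det = 1 ∧
    ∀ x ∈ H4, g.val *ᵥ x ∈ H4}
  mul_mem' := by
    rintro a b ⟨ha, ha', ha''⟩ ⟨hb, hb', hb''⟩
    refine ⟨?_, ?_, ?_⟩
    · rw [Units.val_mul, Matrix.transpose_mul]
      calc b.valᵀ * a.valᵀ * lorentzJ * (a.val * b.val)
          = b.valᵀ * (a.valᵀ * lorentzJ * a.val) * b.val := by simp only [Matrix.mul_assoc]
        _ = lorentzJ := by rw [ha, hb]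
    · rw [Units.val_mul, Matrix.det_mul, ha', hb', one_mul]
    · intro x hx
      rw [Units.val_mul, ← Matrix.mulVec_mulVec]
      exact ha'' _ (hb'' _ hx)
  one_mem' := by simp
  inv_mem' := by
    rintro a ⟨ha, ha', ha''⟩
    have h1 : a.val * (a⁻¹).val = 1 := by simp
    have hL : ((a⁻¹).val)ᵀ * lorentzJ * (a⁻¹).val = lorentzJ := by
      apply transpose_mul_of_lorentz
      intro x y
      rw [← lorentz_mulVec _ ha, Matrix.mulVec_mulVec, Matrix.mulVec_mulVec, h1]
      simp
    refine ⟨hL, ?_, ?_⟩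
    · have := congrArg Matrix.det h1
      rw [Matrix.det_mul, ha', one_mul, Matrix.det_one] at this
      exact this
    · rintro x ⟨hx, hx4⟩
      set y := (a⁻¹).val *ᵥ x with hy
      have hyx : a.val *ᵥ y = x := by rw [hy, Matrix.mulVec_mulVec, h1, Matrix.one_mulVec]
      have hyy : lorentz y y = -1 := by rw [hy, lorentz_mulVec _ hL, hx]
      refine ⟨hyy, ?_⟩
      by_contra hneg
      have hne : y 4 ≠ 0 := by
        intro h0
        rw [lorentz_eq, h0] at hyy
        nlinarith [mul_self_nonneg (y 0), mul_self_nonneg (y 1), mul_self_nonneg (y 2),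
          mul_self_nonneg (y 3)]
      have hlt : y 4 < 0 := lt_of_le_of_ne (not_lt.mp hneg) hne
      have hm : -y ∈ H4 := by
        refine ⟨?_, by simpa using hlt⟩
        rw [lorentz_eq] at hyy ⊢
        simp only [Pi.neg_apply]
        linarith
      have := (ha'' _ hm).2
      rw [Matrix.mulVec_neg, hyx] at this
      simp only [Pi.neg_apply] at this
      linarith

/-- `SO⁺(4,1)` acts on hyperbolic 4-space by matrix multiplication. -/
instance : MulAction SOPlus H4 where
  smul g x := ⟨g.val.val *ᵥ x.val, g.property.2.2 x.val x.property⟩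
  one_smul x := Subtype.ext (Matrix.one_mulVec x.val)
  mul_smul g h x := Subtype.ext (Matrix.mulVec_mulVec x.val g.val.val h.val.val).symm

/-- The base point `e₅` of hyperbolic 4-space. -/
def basePoint : H4 := ⟨Pi.single 4 1, by simp [H4, lorentz_eq]⟩

/-! ### The spin group and its double covering of `SO⁺(4,1)` -/

/-- The matrix `diag(1, -1)` over the quaternions. -/
def quatJ : Matrix (Fin 2) (Fin 2) ℍ[ℝ] := Matrix.diagonal ![1, -1]

/-- The group `SU(1,1;ℍ)` of quaternionic matrices `A` with `A^* J A = J`, which is the standard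
matrix form of `Spin⁺(4,1)`. -/
def SU11H : Subgroup (Matrix (Fin 2) (Fin 2) ℍ[ℝ])ˣ where
  carrier := {A | A.valᴴ * quatJ * A.val = quatJ}
  mul_mem' := by
    intro a b ha hb
    simp only [Set.mem_ofPred_eq] at *
    rw [Units.val_mul, Matrix.conjTranspose_mul]
    calc b.valᴴ * a.valᴴ * quatJ * (a.val * b.val)
        = b.valᴴ * (a.valᴴ * quatJ * a.val) * b.val := by simp only [Matrix.mul_assoc]
      _ = quatJ := by rw [ha, hb]
  one_mem' := by simp
  inv_mem' := by
    intro a ha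
    simp only [Set.mem_ofPred_eq] at *
    have h1 : a.val * (a⁻¹).val = 1 := by simp
    have h2 : ((a⁻¹).val)ᴴ * a.valᴴ = 1 := by
      rw [← Matrix.conjTranspose_mul, h1, Matrix.conjTranspose_one]
    calc ((a⁻¹).val)ᴴ * quatJ * (a⁻¹).val
        = ((a⁻¹).val)ᴴ * (a.valᴴ * quatJ * a.val) * (a⁻¹).val := by rw [ha]
      _ = (((a⁻¹).val)ᴴ * a.valᴴ) * quatJ * (a.val * (a⁻¹).val) := by
          simp only [Matrix.mul_assoc]
      _ = quatJ := by rw [h1, h2, Matrix.one_mul, Matrix.mul_one]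

/-- The quaternion `x₁ + x₂ i + x₃ j + x₄ k`. -/
def quatPart (x : Fin 5 → ℝ) : ℍ[ℝ] := ⟨x 0, x 1, x 2, x 3⟩

@[simp] lemma quatPart_re (x : Fin 5 → ℝ) : (quatPart x).re = x 0 := rfl
@[simp] lemma quatPart_imI (x : Fin 5 → ℝ) : (quatPart x).imI = x 1 := rfl
@[simp] lemma quatPart_imJ (x : Fin 5 → ℝ) : (quatPart x).imJ = x 2 := rfl
@[simp] lemma quatPart_imK (x : Fin 5 → ℝ) : (quatPart x).imK = x 3 := rfl

/-- `ℝ^{4,1}` as the space of quaternionic Hermitian matrices with rows `(t, q)`, `(q̄, t)`. -/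
def toHerm : (Fin 5 → ℝ) →ₗ[ℝ] Matrix (Fin 2) (Fin 2) ℍ[ℝ] where
  toFun x := !![(x 4 : ℍ[ℝ]), quatPart x; star (quatPart x), (x 4 : ℍ[ℝ])]
  map_add' x y := by
    ext i j <;> fin_cases i <;> fin_cases j <;> simp <;> ring
  map_smul' r x := by
    ext i j <;> fin_cases i <;> fin_cases j <;> simp

/-- The coordinates in `ℝ^{4,1}` of a Hermitian matrix with rows `(t, q)`, `(q̄, t)`. -/
def ofHerm : Matrix (Fin 2) (Fin 2) ℍ[ℝ] →ₗ[ℝ] (Fin 5 → ℝ) where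
  toFun X := ![(X 0 1).re, (X 0 1).imI, (X 0 1).imJ, (X 0 1).imK, (X 0 0).re]
  map_add' X Y := by ext i; fin_cases i <;> simp
  map_smul' r X := by ext i; fin_cases i <;> simp

/-- The map `X ↦ A X A^*`. -/
def hermConj (A : Matrix (Fin 2) (Fin 2) ℍ[ℝ]) :
    Matrix (Fin 2) (Fin 2) ℍ[ℝ] →ₗ[ℝ] Matrix (Fin 2) (Fin 2) ℍ[ℝ] where
  toFun X := A * X * Aᴴ
  map_add' X Y := by rw [Matrix.mul_add, Matrix.add_mul]
  map_smul' r X := by simp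

/-- The `5 × 5` matrix of the linear map `X ↦ A X A^*` on `ℝ^{4,1}`. -/
def etaMatrix (A : Matrix (Fin 2) (Fin 2) ℍ[ℝ]) : Matrix (Fin 5) (Fin 5) ℝ :=
  LinearMap.toMatrix' (ofHerm ∘ₗ hermConj A ∘ₗ toHerm)

lemma etaMatrix_mulVec (A : Matrix (Fin 2) (Fin 2) ℍ[ℝ]) (x : Fin 5 → ℝ) :
    etaMatrix A *ᵥ x = ofHerm (A * toHerm x * Aᴴ) := by
  rw [etaMatrix, LinearMap.toMatrix'_mulVec]
  rfl

lemma ofHerm_toHerm (x : Fin 5 → ℝ) : ofHerm (toHerm x) = x := by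
  ext i; fin_cases i <;> simp [ofHerm, toHerm]

lemma quatJ_mul_self : quatJ * quatJ = 1 := by
  ext i j <;> fin_cases i <;> fin_cases j <;> simp [quatJ]

lemma SU11H_right (A : SU11H) : A.val.val * quatJ * A.val.valᴴ = quatJ := by
  have hA : A.val.valᴴ * quatJ * A.val.val = quatJ := A.property
  have h1 : (quatJ * A.val.valᴴ * quatJ) * A.val.val = 1 := by
    rw [Matrix.mul_assoc, Matrix.mul_assoc, ← Matrix.mul_assoc _ quatJ, hA, quatJ_mul_self]
  have h2 : quatJ * A.val.valᴴ * quatJ = (A.val⁻¹).val := by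
    rw [← Matrix.mul_one (quatJ * A.val.valᴴ * quatJ), ← Units.mul_inv A.val,
      ← Matrix.mul_assoc, h1, Matrix.one_mul]
  have h3 : A.val.val * (quatJ * A.val.valᴴ * quatJ) = 1 := by rw [h2, Units.mul_inv]
  calc A.val.val * quatJ * A.val.valᴴ
      = A.val.val * (quatJ * A.val.valᴴ * quatJ) * quatJ := by
        simp only [Matrix.mul_assoc, quatJ_mul_self, Matrix.mul_one]
    _ = quatJ := by rw [h3, Matrix.one_mul]

/-- The entrywise form of `A^* J A = J`. -/
lemma SU11H_entries (A : SU11H) :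
    star (A.val.val 0 0) * A.val.val 0 0 - star (A.val.val 1 0) * A.val.val 1 0 = 1 ∧
    star (A.val.val 0 0) * A.val.val 0 1 = star (A.val.val 1 0) * A.val.val 1 1 ∧
    star (A.val.val 0 1) * A.val.val 0 1 - star (A.val.val 1 1) * A.val.val 1 1 = -1 := by
  have hA : A.val.valᴴ * quatJ * A.val.val = quatJ := A.property
  have h00 := congrFun (congrFun hA 0) 0
  have h01 := congrFun (congrFun hA 0) 1
  have h11 := congrFun (congrFun hA 1) 1
  simp [quatJ, Matrix.mul_apply, Fin.sum_univ_two, Matrix.diagonal_apply] at h00 h01 h11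
  refine ⟨?_, ?_, ?_⟩
  · rw [← h00]; abel
  · rw [← sub_eq_zero, ← h01]; abel
  · rw [← h11]; abel

lemma SU11H_entries' (A : SU11H) :
    A.val.val 0 0 * star (A.val.val 0 0) - A.val.val 0 1 * star (A.val.val 0 1) = 1 := by
  have h00 := congrFun (congrFun (SU11H_right A) 0) 0
  simp [quatJ, Matrix.mul_apply, Fin.sum_univ_two, Matrix.diagonal_apply] at h00
  rw [← h00]; abel

lemma hermConj_diag (A : SU11H) (x : Fin 5 → ℝ) :
    ((A.val.val * toHerm x * A.val.valᴴ) 0 0).re =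
      ((A.val.val * toHerm x * A.val.valᴴ) 1 1).re := by
  obtain ⟨h1, h2, h3⟩ := SU11H_entries A
  have h1r := congrArg (fun q : ℍ[ℝ] => q.re) h1
  have h3r := congrArg (fun q : ℍ[ℝ] => q.re) h3
  have h20 := congrArg (fun q : ℍ[ℝ] => q.re) h2
  have h21 := congrArg (fun q : ℍ[ℝ] => q.imI) h2
  have h22 := congrArg (fun q : ℍ[ℝ] => q.imJ) h2
  have h23 := congrArg (fun q : ℍ[ℝ] => q.imK) h2
  simp at h1r h3r h20 h21 h22 h23
  simp [toHerm, Matrix.mul_apply, Fin.sum_univ_two]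
  linear_combination (x 4) * h1r + (x 4) * h3r + 2 * x 0 * h20 + 2 * x 1 * h21
    + 2 * x 2 * h22 + 2 * x 3 * h23

lemma toHerm_conjTranspose (x : Fin 5 → ℝ) : (toHerm x)ᴴ = toHerm x := by
  ext i j <;> fin_cases i <;> fin_cases j <;> simp [toHerm]

lemma toHerm_ofHerm (Y : Matrix (Fin 2) (Fin 2) ℍ[ℝ]) (hY : Yᴴ = Y)
    (hd : (Y 0 0).re = (Y 1 1).re) : toHerm (ofHerm Y) = Y := by
  have h00 := congrFun (congrFun hY 0) 0
  have h11 := congrFun (congrFun hY 1) 1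
  have h10 := congrFun (congrFun hY 1) 0
  rw [Matrix.conjTranspose_apply] at h00 h11 h10
  have e0 := congrArg (fun q : ℍ[ℝ] => q.imI) h00
  have e1 := congrArg (fun q : ℍ[ℝ] => q.imJ) h00
  have e2 := congrArg (fun q : ℍ[ℝ] => q.imK) h00
  have f0 := congrArg (fun q : ℍ[ℝ] => q.imI) h11
  have f1 := congrArg (fun q : ℍ[ℝ] => q.imJ) h11
  have f2 := congrArg (fun q : ℍ[ℝ] => q.imK) h11
  simp at e0 e1 e2 f0 f1 f2
  ext i j <;> fin_cases i <;> fin_cases j <;> simp [toHerm, ofHerm, ← h10] <;> linarith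

lemma toHerm_etaMatrix (A : SU11H) (x : Fin 5 → ℝ) :
    toHerm (etaMatrix A.val.val *ᵥ x) = A.val.val * toHerm x * A.val.valᴴ := by
  rw [etaMatrix_mulVec]
  apply toHerm_ofHerm _ _ (hermConj_diag A x)
  rw [Matrix.conjTranspose_mul, Matrix.conjTranspose_mul, Matrix.conjTranspose_conjTranspose,
    toHerm_conjTranspose, Matrix.mul_assoc]

lemma toHerm_sq (x : Fin 5 → ℝ) :
    toHerm x * quatJ * toHerm x = (-lorentz x x) • quatJ := by
  rw [lorentz_eq]
  ext i j <;> fin_cases i <;> fin_cases j <;>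
    simp [toHerm, quatJ, Matrix.mul_apply, Fin.sum_univ_two, Matrix.vecMul_diagonal] <;> ring

lemma lorentz_self_etaMatrix (A : SU11H) (x : Fin 5 → ℝ) :
    lorentz (etaMatrix A.val.val *ᵥ x) (etaMatrix A.val.val *ᵥ x) = lorentz x x := by
  have hA : A.val.valᴴ * quatJ * A.val.val = quatJ := A.property
  have h := toHerm_sq (etaMatrix A.val.val *ᵥ x)
  rw [toHerm_etaMatrix] at h
  have h2 : A.val.val * toHerm x * A.val.valᴴ * quatJ * (A.val.val * toHerm x * A.val.valᴴ)
      = (-lorentz x x) • quatJ := by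
    calc A.val.val * toHerm x * A.val.valᴴ * quatJ * (A.val.val * toHerm x * A.val.valᴴ)
        = A.val.val * (toHerm x * (A.val.valᴴ * quatJ * A.val.val) * toHerm x) * A.val.valᴴ := by
          simp only [Matrix.mul_assoc]
      _ = (-lorentz x x) • quatJ := by
          rw [hA, toHerm_sq, Matrix.mul_smul, Matrix.smul_mul, SU11H_right]
  rw [h2] at h
  have h3 := congrArg (fun q : ℍ[ℝ] => q.re) (congrFun (congrFun h 0) 0)
  simp [quatJ] at h3
  exact h3.symm

lemma etaMatrix_lorentz (A : SU11H) :
    (etaMatrix A.val.val)ᵀ * lorentzJ * etaMatrix A.val.val = lorentzJ := by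
  apply transpose_mul_of_lorentz
  intro x y
  have h1 := lorentz_self_etaMatrix A (x + y)
  have h2 := lorentz_self_etaMatrix A x
  have h3 := lorentz_self_etaMatrix A y
  rw [Matrix.mulVec_add] at h1
  simp only [lorentz_eq, Pi.add_apply] at h1 h2 h3 ⊢
  linarith

lemma etaMatrix_one : etaMatrix 1 = 1 := by
  apply Matrix.ext_of_mulVec_single
  intro i
  rw [etaMatrix_mulVec, Matrix.one_mulVec, Matrix.conjTranspose_one, Matrix.one_mul,
    Matrix.mul_one, ofHerm_toHerm]

lemma etaMatrix_mul (A B : SU11H) :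
    etaMatrix (A.val.val * B.val.val) = etaMatrix A.val.val * etaMatrix B.val.val := by
  apply Matrix.ext_of_mulVec_single
  intro i
  rw [← Matrix.mulVec_mulVec, etaMatrix_mulVec, etaMatrix_mulVec A.val.val, toHerm_etaMatrix,
    Matrix.conjTranspose_mul]
  simp only [Matrix.mul_assoc]

lemma etaMatrix_H4 (A : SU11H) (x : Fin 5 → ℝ) (hx : x ∈ H4) :
    etaMatrix A.val.val *ᵥ x ∈ H4 := by
  obtain ⟨hx1, hx4⟩ := hx
  refine ⟨by rw [lorentz_self_etaMatrix, hx1], ?_⟩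
  have h1 := congrArg (fun q : ℍ[ℝ] => q.re) (SU11H_entries' A)
  set a := A.val.val 0 0 with ha
  set b := A.val.val 0 1 with hb
  have hval : (etaMatrix A.val.val *ᵥ x) 4
      = x 4 * (‖a‖ ^ 2 + ‖b‖ ^ 2) + 2 * inner ℝ (a * quatPart x) b := by
    rw [etaMatrix_mulVec, ← real_inner_self_eq_norm_sq a, ← real_inner_self_eq_norm_sq b]
    simp only [Quaternion.inner_def]
    simp [ofHerm, toHerm, Matrix.mul_apply, Fin.sum_univ_two, ← ha, ← hb]
    ring
  have hin := abs_le.mp (abs_real_inner_le_norm (a * quatPart x) b)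
  rw [norm_mul] at hin
  have hab : ‖a‖ ^ 2 - ‖b‖ ^ 2 = 1 := by
    rw [← real_inner_self_eq_norm_sq a, ← real_inner_self_eq_norm_sq b]
    simp only [Quaternion.inner_def]
    simpa using h1
  have hq : ‖quatPart x‖ ^ 2 = (x 4) ^ 2 - 1 := by
    rw [← real_inner_self_eq_norm_sq]
    rw [lorentz_eq] at hx1
    simp only [Quaternion.inner_def]
    simp
    linarith
  have hqt : ‖quatPart x‖ < x 4 := by
    apply lt_of_pow_lt_pow_left₀ 2 hx4.le
    linarith
  rw [hval]
  have hn := norm_nonneg (quatPart x)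
  have hp : 0 < x 4 * (‖a‖ ^ 2 + ‖b‖ ^ 2) - 2 * (‖a‖ * ‖quatPart x‖ * ‖b‖) := by
    nlinarith [mul_nonneg hn (sq_nonneg (‖a‖ - ‖b‖)), sq_nonneg ‖b‖,
      mul_pos (sub_pos.mpr hqt) (show 0 < ‖a‖ ^ 2 + ‖b‖ ^ 2 by nlinarith [sq_nonneg ‖b‖])]
  linarith [hin.1]

lemma det_sq_of_lorentz (g : Matrix (Fin 5) (Fin 5) ℝ) (hg : gᵀ * lorentzJ * g = lorentzJ) :
    g.det * g.det = 1 := by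
  have h := congrArg Matrix.det hg
  have hJ : lorentzJ.det = -1 := by
    simp [lorentzJ, Matrix.det_diagonal, Fin.prod_univ_five, Matrix.cons_val_four]
  rw [Matrix.det_mul, Matrix.det_mul, Matrix.det_transpose, hJ] at h
  linarith

lemma det_etaMatrix_sq (A : SU11H) : (etaMatrix (A * A).val.val).det = 1 := by
  have : (A * A).val.val = A.val.val * A.val.val := rfl
  rw [this, etaMatrix_mul, Matrix.det_mul]
  exact det_sq_of_lorentz _ (etaMatrix_lorentz A)

/-- A matrix with `m^* J m = J` and `m J m^* = J` as an element of `SU(1,1;ℍ)`. -/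
def SU11H.mk (m : Matrix (Fin 2) (Fin 2) ℍ[ℝ]) (h : mᴴ * quatJ * m = quatJ)
    (h' : m * quatJ * mᴴ = quatJ) : SU11H :=
  ⟨⟨m, quatJ * mᴴ * quatJ, by
      rw [← Matrix.mul_assoc, ← Matrix.mul_assoc, h', quatJ_mul_self], by
      rw [Matrix.mul_assoc, Matrix.mul_assoc, ← Matrix.mul_assoc _ quatJ, h, quatJ_mul_self]⟩, h⟩

lemma exists_sqrt_unit (p : ℍ[ℝ]) (hp : star p * p = 1) :
    ∃ s : ℍ[ℝ], s * s = p ∧ star s * s = 1 ∧ s * star s = 1 := by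
  rw [Quaternion.star_mul_self] at hp
  have hp1 := congrArg (fun q : ℍ[ℝ] => q.re) hp
  simp only [Quaternion.re_coe, Quaternion.normSq_def', Quaternion.re_one] at hp1
  have main : ∃ s : ℍ[ℝ], s * s = p ∧ Quaternion.normSq s = 1 := by
    by_cases h : p.re = -1
    · have h1 : p.imI = 0 := by nlinarith [sq_nonneg p.imI, sq_nonneg p.imJ, sq_nonneg p.imK]
      have h2 : p.imJ = 0 := by nlinarith [sq_nonneg p.imI, sq_nonneg p.imJ, sq_nonneg p.imK]
      have h3 : p.imK = 0 := by nlinarith [sq_nonneg p.imI, sq_nonneg p.imJ, sq_nonneg p.imK]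
      obtain ⟨s, s0, s1, s2, s3⟩ : ∃ s : ℍ[ℝ], s.re = 0 ∧ s.imI = 1 ∧ s.imJ = 0 ∧ s.imK = 0 :=
        ⟨⟨0, 1, 0, 0⟩, rfl, rfl, rfl, rfl⟩
      refine ⟨s, ?_, ?_⟩
      · ext <;> simp [s0, s1, s2, s3, h, h1, h2, h3]
      · simp [Quaternion.normSq_def', s0, s1, s2, s3]
    · have hre : 0 < 2 + 2 * p.re := by
        have : -1 ≤ p.re := by nlinarith [sq_nonneg p.imI, sq_nonneg p.imJ, sq_nonneg p.imK]
        have := lt_of_le_of_ne this (Ne.symm h)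
        linarith
      obtain ⟨n, hn0, hnn⟩ : ∃ n : ℝ, n ≠ 0 ∧ n * n = 2 + 2 * p.re :=
        ⟨√(2 + 2 * p.re), by positivity, Real.mul_self_sqrt hre.le⟩
      have hi : n⁻¹ * n⁻¹ * (2 + 2 * p.re) = 1 := by rw [← hnn]; field_simp
      refine ⟨n⁻¹ • (1 + p), ?_, ?_⟩
      · ext <;> simp
        · linear_combination p.re * hi - n⁻¹ * n⁻¹ * hp1
        · linear_combination p.imI * hi
        · linear_combination p.imJ * hi
        · linear_combination p.imK * hi
      · simp [Quaternion.normSq_def']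
        linear_combination hi + n⁻¹ * n⁻¹ * hp1
  obtain ⟨s, hs, hn⟩ := main
  exact ⟨s, hs, by rw [Quaternion.star_mul_self, hn]; simp,
    by rw [Quaternion.self_mul_star, hn]; simp⟩

/-- Every element of `SU(1,1;ℍ)` is a product of three squares, by the polar decomposition. -/
lemma exists_three_squares (A : SU11H) :
    ∃ P Q R : SU11H, A = (P * P) * (Q * Q) * (R * R) := by
  obtain ⟨h1, h2, h3⟩ := SU11H_entries A
  have h4 := SU11H_entries' A
  set a := A.val.val 0 0 with ha
  set b := A.val.val 0 1 with hb
  set c := A.val.val 1 0 with hc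
  set d := A.val.val 1 1 with hd
  rw [Quaternion.star_mul_self, Quaternion.star_mul_self] at h1 h3
  rw [Quaternion.self_mul_star, Quaternion.self_mul_star] at h4
  replace h1 := congrArg (fun q : ℍ[ℝ] => q.re) h1
  replace h3 := congrArg (fun q : ℍ[ℝ] => q.re) h3
  replace h4 := congrArg (fun q : ℍ[ℝ] => q.re) h4
  simp only [Quaternion.re_sub, Quaternion.re_coe, Quaternion.re_one, Quaternion.re_neg]
    at h1 h3 h4
  have hb0 : 0 ≤ Quaternion.normSq b := Quaternion.normSq_nonneg
  have hda : Quaternion.normSq d = Quaternion.normSq a := by linarith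
  obtain ⟨r, hr1, hrr⟩ : ∃ r : ℝ, 1 ≤ r ∧ r * r = Quaternion.normSq a := by
    refine ⟨√(Quaternion.normSq a), ?_, Real.mul_self_sqrt (by linarith)⟩
    rw [Real.one_le_sqrt]
    linarith
  have hr0 : r ≠ 0 := by linarith
  have unit : ∀ q : ℍ[ℝ], Quaternion.normSq q = r * r →
      star (r⁻¹ • q) * (r⁻¹ • q) = 1 := by
    intro q hq
    rw [Quaternion.star_mul_self, Quaternion.normSq_smul, hq]
    have : r⁻¹ ^ 2 * (r * r) = 1 := by field_simp
    rw [this]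
    simp
  obtain ⟨s, hs, hs1, hs2⟩ := exists_sqrt_unit (r⁻¹ • a) (unit a hrr.symm)
  obtain ⟨w, hw, hw1, hw2⟩ := exists_sqrt_unit (r⁻¹ • d) (unit d (by rw [hda, hrr]))
  obtain ⟨x, hx0, hxx⟩ : ∃ x : ℝ, x ≠ 0 ∧ x * x = (r + 1) / 2 :=
    ⟨√((r + 1) / 2), by positivity, Real.mul_self_sqrt (by linarith)⟩
  -- the off-diagonal entry of the positive part, and of its square root
  set β : ℍ[ℝ] := r⁻¹ • (star a * b) with hβ
  have hβn : Quaternion.normSq β = r ^ 2 - 1 := by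
    rw [hβ, Quaternion.normSq_smul, map_mul, Quaternion.normSq_star, ← hrr]
    have : Quaternion.normSq b = r ^ 2 - 1 := by linarith
    rw [this]
    field_simp
  set z : ℍ[ℝ] := (2 * x)⁻¹ • β with hz
  have hzn : Quaternion.normSq z = (r - 1) / 2 := by
    rw [hz, Quaternion.normSq_smul, hβn]
    have : (2 * x)⁻¹ ^ 2 = (2 * (r + 1))⁻¹ := by
      rw [inv_pow, show (2 * x) ^ 2 = 4 * (x * x) by ring, hxx]
      congr 1
      ring
    rw [this]
    have : r + 1 ≠ 0 := by linarith
    field_simp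
    ring
  obtain ⟨α, hα⟩ : ∃ α : ℝ, α = (r + 1) / 2 := ⟨_, rfl⟩
  obtain ⟨γ, hγ⟩ : ∃ γ : ℝ, γ = (r - 1) / 2 := ⟨_, rfl⟩
  have hzz : z * star z = (γ : ℍ[ℝ]) := by rw [Quaternion.self_mul_star, hzn, hγ]
  have hzz' : star z * z = (γ : ℍ[ℝ]) := by rw [Quaternion.star_mul_self, hzn, hγ]
  have hxxq : (x : ℍ[ℝ]) * (x : ℍ[ℝ]) = (α : ℍ[ℝ]) := by rw [← Quaternion.coe_mul, hxx, hα]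
  have hcomm : (x : ℍ[ℝ]) * z = z * x := (Quaternion.coe_commutes x z)
  have hcomm' : (x : ℍ[ℝ]) * star z = star z * x := (Quaternion.coe_commutes x (star z))
  have hone : (α : ℍ[ℝ]) - (γ : ℍ[ℝ]) = 1 := by
    rw [← Quaternion.coe_sub, show α - γ = 1 by rw [hα, hγ]; ring, Quaternion.coe_one]
  have hone' : (γ : ℍ[ℝ]) - (α : ℍ[ℝ]) = -1 := by
    rw [← neg_sub, hone]
  have hsum : (α : ℍ[ℝ]) + (γ : ℍ[ℝ]) = r := by
    rw [← Quaternion.coe_add, show α + γ = r by rw [hα, hγ]; ring]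
  have h2z : (x : ℍ[ℝ]) * z + z * x = β := by
    rw [← hcomm, ← two_mul, hz, Quaternion.coe_mul_eq_smul, smul_smul, two_mul, ← add_smul]
    rw [show x * (2 * x)⁻¹ + x * (2 * x)⁻¹ = 1 by field_simp; norm_num, one_smul]
  have h2z' : star z * (x : ℍ[ℝ]) + x * star z = star β := by
    rw [← h2z]
    simp [add_comm]
  let P : SU11H := SU11H.mk !![s, 0; 0, 1]
    (by ext1 i j; fin_cases i <;> fin_cases j <;>
          simp [quatJ, Matrix.mul_apply, Fin.sum_univ_two, hs1])
    (by ext1 i j; fin_cases i <;> fin_cases j <;>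
          simp [quatJ, Matrix.mul_apply, Fin.sum_univ_two, Matrix.vecMul_diagonal, hs2])
  let Q : SU11H := SU11H.mk !![1, 0; 0, w]
    (by ext1 i j; fin_cases i <;> fin_cases j <;>
          simp [quatJ, Matrix.mul_apply, Fin.sum_univ_two, hw1])
    (by ext1 i j; fin_cases i <;> fin_cases j <;>
          simp [quatJ, Matrix.mul_apply, Fin.sum_univ_two, Matrix.vecMul_diagonal, hw2])
  let R : SU11H := SU11H.mk !![(x : ℍ[ℝ]), z; star z, (x : ℍ[ℝ])]
    (by ext1 i j; fin_cases i <;> fin_cases j <;>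
          simp [quatJ, Matrix.mul_apply, Fin.sum_univ_two, hxxq, hzz,
            hzz', hcomm, hcomm', ← sub_eq_add_neg, hone, hone'])
    (by ext1 i j; fin_cases i <;> fin_cases j <;>
          simp [quatJ, Matrix.mul_apply, Fin.sum_univ_two, Matrix.vecMul_diagonal, hxxq, hzz,
            hzz', hcomm, hcomm', ← sub_eq_add_neg, hone, hone'])
  have hPP : (P * P).val.val = !![r⁻¹ • a, 0; 0, 1] := by
    change !![s, 0; 0, 1] * !![s, 0; 0, 1] = _
    simp [hs]
  have hQQ : (Q * Q).val.val = !![1, 0; 0, r⁻¹ • d] := by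
    change !![1, 0; 0, w] * !![1, 0; 0, w] = _
    simp [hw]
  have hRR : (R * R).val.val = !![(r : ℍ[ℝ]), β; star β, (r : ℍ[ℝ])] := by
    change !![(x : ℍ[ℝ]), z; star z, (x : ℍ[ℝ])] * !![(x : ℍ[ℝ]), z; star z, (x : ℍ[ℝ])] = _
    rw [Matrix.mul_fin_two, hxxq, hzz, hzz', hsum, h2z, h2z', add_comm, hsum]
  refine ⟨P, Q, R, ?_⟩
  apply Subtype.ext
  apply Units.ext
  change A.val.val = (P * P).val.val * (Q * Q).val.val * (R * R).val.val
  have hri : r⁻¹ * r⁻¹ * (r * r) = 1 := by field_simp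
  have hsβ : star β = r⁻¹ • (star d * c) := by
    rw [hβ, h2]
    simp
  rw [hPP, hQQ, hRR]
  ext1 i j
  fin_cases i <;> fin_cases j
  · simp [← ha, Quaternion.mul_coe_eq_smul, smul_smul, hr0]
  · simp only [Matrix.mul_fin_two]
    simp [← hb, hβ, smul_smul, ← mul_assoc, Quaternion.self_mul_star, ← hrr]
    rw [← Quaternion.coe_mul, Quaternion.coe_mul_eq_smul, smul_smul, hri, one_smul]
  · simp only [Matrix.mul_fin_two]
    simp [← hc, hsβ, smul_smul, ← mul_assoc, Quaternion.self_mul_star, hda, ← hrr]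
    rw [← Quaternion.coe_mul, Quaternion.coe_mul_eq_smul, smul_smul, hri, one_smul]
  · simp [← hd, Quaternion.mul_coe_eq_smul, smul_smul, hr0]

lemma det_etaMatrix (A : SU11H) : (etaMatrix A.val.val).det = 1 := by
  obtain ⟨P, Q, R, rfl⟩ := exists_three_squares A
  have h : ((P * P) * (Q * Q) * (R * R)).val.val
      = ((P * P) * (Q * Q)).val.val * (R * R).val.val := rfl
  have h' : ((P * P) * (Q * Q)).val.val = (P * P).val.val * (Q * Q).val.val := rfl
  rw [h, etaMatrix_mul, h', etaMatrix_mul, Matrix.det_mul, Matrix.det_mul, det_etaMatrix_sq,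
    det_etaMatrix_sq, det_etaMatrix_sq]
  norm_num

/-- The double covering homomorphism `η : SU(1,1;ℍ) → SO⁺(4,1)`, given by the action
`X ↦ A X A^*` on `ℝ^{4,1}`. -/
def eta : SU11H →* SOPlus :=
  (MonoidHom.toHomUnits
    { toFun := fun A : SU11H => etaMatrix A.val.val
      map_one' := etaMatrix_one
      map_mul' := etaMatrix_mul }).codRestrict SOPlus
    (fun A => ⟨etaMatrix_lorentz A, det_etaMatrix A, etaMatrix_H4 A⟩)

/-! ### The Davis group -/

/-- The `5 × 5` matrix of the hyperbolic translation by the distance `s` along the geodesic line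
through the base point `e₅` in the direction of the unit vector `u`. -/
def translation (u : Fin 4 → ℝ) (s : ℝ) : Matrix (Fin 5) (Fin 5) ℝ :=
  let U : Fin 5 → ℝ := ![u 0, u 1, u 2, u 3, 0]
  let E : Fin 5 → ℝ := ![0, 0, 0, 0, 1]
  1 + (Real.cosh s - 1) • (Matrix.vecMulVec U U + Matrix.vecMulVec E E)
    + Real.sinh s • (Matrix.vecMulVec U E + Matrix.vecMulVec E U)

/-- The 120 vertices of the regular 600-cell in the unit 3-sphere: all vectors obtained from
`(2, 0, 0, 0) / 2`, `(1, 1, 1, 1) / 2` and `(0, 1, τ, τ⁻¹) / 2`, where `τ` is the golden ratio, by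
even permutations of the coordinates and arbitrary changes of signs. These are the directions, seen
from its center, of the centers of the sides of a regular 120-cell centered at `e₅`. -/
def sideDirections : Set (Fin 4 → ℝ) :=
  {u | ∃ w ∈ ({![2, 0, 0, 0], ![1, 1, 1, 1],
        ![0, 1, Real.goldenRatio, Real.goldenRatio⁻¹]} : Set (Fin 4 → ℝ)),
      ∃ p ∈ alternatingGroup (Fin 4), ∃ ε : Fin 4 → ℤˣ,
      ∀ i, u i = ((ε i : ℤ) : ℝ) * w (p i) / 2}

/-- The distance from the center of the regular hyperbolic 120-cell with dihedral angle `2π/5` to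
its sides. Its hyperbolic cosine is the square of the golden ratio. -/
def inradius : ℝ := Real.arcosh (Real.goldenRatio ^ 2)

/-- The outward unit normal of the side, in the direction `u`, of the regular 120-cell centered at
`e₅` with inradius `r`; this 120-cell consists of the `x` in `H4` with
`lorentz x (sideNormal r u) ≤ 0` for all `u` in `sideDirections`. -/
def sideNormal (r : ℝ) (u : Fin 4 → ℝ) : Fin 5 → ℝ :=
  ![Real.cosh r * u 0, Real.cosh r * u 1, Real.cosh r * u 2, Real.cosh r * u 3, Real.sinh r]

/-- Sides of the 120-cell are adjacent if the angle between their directions is `π/5`, and then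
the dihedral angle between them is `2π/5`. -/
lemma lorentz_sideNormal (u v : Fin 4 → ℝ)
    (h : u 0 * v 0 + u 1 * v 1 + u 2 * v 2 + u 3 * v 3 = Real.cos (Real.pi / 5)) :
    lorentz (sideNormal inradius u) (sideNormal inradius v) = -Real.cos (2 * Real.pi / 5) := by
  have hc : Real.cosh inradius = Real.goldenRatio ^ 2 :=
    Real.cosh_arcosh (by nlinarith [Real.one_lt_goldenRatio])
  have hs : Real.sinh inradius ^ 2 = Real.goldenRatio ^ 4 - 1 := by
    rw [Real.sinh_sq, hc]; ring
  have hφ := Real.goldenRatio_sq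
  have h5 : Real.cos (Real.pi / 5) = Real.goldenRatio / 2 := by
    rw [Real.cos_pi_div_five, Real.goldenRatio]; ring
  have h52 : Real.cos (2 * Real.pi / 5) = (Real.goldenRatio - 1) / 2 := by
    rw [show 2 * Real.pi / 5 = 2 * (Real.pi / 5) by ring, Real.cos_two_mul, h5]
    linear_combination (1 / 2) * hφ
  rw [h5] at h
  rw [lorentz_eq, h52]
  simp only [sideNormal, hc]
  generalize Real.goldenRatio = t at *
  have h4 : t ^ 4 = 3 * t + 2 := by linear_combination (t ^ 2 + t + 2) * hφ
  have h5' : t ^ 5 = 5 * t + 3 := by linear_combination t * h4 + 3 * hφ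
  simp [Matrix.cons_val_four]
  linear_combination t ^ 4 * h - hs + h5' / 2 - h4

lemma translation_mulVec (u : Fin 4 → ℝ) (s : ℝ) (x : Fin 5 → ℝ) :
    translation u s *ᵥ x =
      let m := (Real.cosh s - 1) * (u 0 * x 0 + u 1 * x 1 + u 2 * x 2 + u 3 * x 3)
        + Real.sinh s * x 4
      ![x 0 + m * u 0, x 1 + m * u 1, x 2 + m * u 2, x 3 + m * u 3,
        Real.sinh s * (u 0 * x 0 + u 1 * x 1 + u 2 * x 2 + u 3 * x 3) + Real.cosh s * x 4] := by
  ext i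
  fin_cases i <;>
    simp [translation, dotProduct, Fin.sum_univ_five, Matrix.mulVec, Matrix.one_apply] <;> ring

/-- The translation by `2r` in the direction `u` carries the hyperplane of the side in the
direction `-u` of the 120-cell of inradius `r` to the hyperplane of the side in the direction `u`,
and the 120-cell to the far side of the latter. -/
lemma translation_sideNormal (u : Fin 4 → ℝ) (hu : u 0 ^ 2 + u 1 ^ 2 + u 2 ^ 2 + u 3 ^ 2 = 1)
    (r : ℝ) : translation u (2 * r) *ᵥ sideNormal r (-u) = -sideNormal r u := by
  have h := Real.cosh_sq r
  rw [translation_mulVec, Real.cosh_two_mul, Real.sinh_two_mul]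
  ext i
  fin_cases i <;> simp [sideNormal]
  · left
    linear_combination (-(Real.cosh r ^ 2 + Real.sinh r ^ 2 - 1) * Real.cosh r) * hu
      - Real.cosh r * h
  · left
    linear_combination (-(Real.cosh r ^ 2 + Real.sinh r ^ 2 - 1) * Real.cosh r) * hu
      - Real.cosh r * h
  · left
    linear_combination (-(Real.cosh r ^ 2 + Real.sinh r ^ 2 - 1) * Real.cosh r) * hu
      - Real.cosh r * h
  · left
    linear_combination (-(Real.cosh r ^ 2 + Real.sinh r ^ 2 - 1) * Real.cosh r) * hu
      - Real.cosh r * h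
  · linear_combination (-2 * Real.sinh r * Real.cosh r ^ 2) * hu - Real.sinh r * h

/-- The hyperbolic translations along geodesic lines through `e₅` lie in `SO⁺(4,1)`. -/
lemma exists_eta_eq_translation (u : Fin 4 → ℝ)
    (hu : u 0 ^ 2 + u 1 ^ 2 + u 2 ^ 2 + u 3 ^ 2 = 1) (s : ℝ) :
    ∃ A : SU11H, (eta A).val.val = translation u s := by
  obtain ⟨q, q0, q1, q2, q3⟩ :
      ∃ q : ℍ[ℝ], q.re = u 0 ∧ q.imI = u 1 ∧ q.imJ = u 2 ∧ q.imK = u 3 :=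
    ⟨⟨u 0, u 1, u 2, u 3⟩, rfl, rfl, rfl, rfl⟩
  obtain ⟨C, hC⟩ : ∃ C : ℝ, C = Real.cosh (s / 2) := ⟨_, rfl⟩
  obtain ⟨S, hS⟩ : ∃ S : ℝ, S = Real.sinh (s / 2) := ⟨_, rfl⟩
  have hCS : C ^ 2 - S ^ 2 = 1 := by rw [hC, hS, Real.cosh_sq]; ring
  have hc : Real.cosh s = C ^ 2 + S ^ 2 := by
    rw [hC, hS, ← Real.cosh_two_mul]; ring_nf
  have hs : Real.sinh s = 2 * S * C := by
    rw [hC, hS, ← Real.sinh_two_mul]; ring_nf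
  have hm : !![(C : ℍ[ℝ]), S • q; S • star q, (C : ℍ[ℝ])] * quatJ
      * !![(C : ℍ[ℝ]), S • q; S • star q, (C : ℍ[ℝ])] = quatJ := by
    ext i j <;> fin_cases i <;> fin_cases j <;>
      simp [quatJ, Matrix.mul_apply, Fin.sum_univ_two, Matrix.vecMul_diagonal, q0, q1, q2, q3] <;>
      first
        | ring1
        | (right; ring1)
        | linear_combination hCS - S ^ 2 * hu
        | linear_combination -hCS + S ^ 2 * hu
  have hT : (!![(C : ℍ[ℝ]), S • q; S • star q, (C : ℍ[ℝ])])ᴴ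
      = !![(C : ℍ[ℝ]), S • q; S • star q, (C : ℍ[ℝ])] := by
    ext i j <;> fin_cases i <;> fin_cases j <;> simp
  refine ⟨SU11H.mk _ (by rw [hT]; exact hm) (by rw [hT]; exact hm), ?_⟩
  change etaMatrix !![(C : ℍ[ℝ]), S • q; S • star q, (C : ℍ[ℝ])] = _
  apply Matrix.ext_of_mulVec_single
  intro k
  generalize (Pi.single k (1 : ℝ) : Fin 5 → ℝ) = x
  rw [etaMatrix_mulVec, hT, translation_mulVec, hc, hs]
  ext i
  fin_cases i <;>
    simp [ofHerm, toHerm, Matrix.mul_apply, Fin.sum_univ_two, q0, q1, q2, q3]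
  · linear_combination x 0 * hCS - S ^ 2 * x 0 * hu
      - u 0 * (u 0 * x 0 + u 1 * x 1 + u 2 * x 2 + u 3 * x 3) * hCS
  · linear_combination x 1 * hCS - S ^ 2 * x 1 * hu
      - u 1 * (u 0 * x 0 + u 1 * x 1 + u 2 * x 2 + u 3 * x 3) * hCS
  · linear_combination x 2 * hCS - S ^ 2 * x 2 * hu
      - u 2 * (u 0 * x 0 + u 1 * x 1 + u 2 * x 2 + u 3 * x 3) * hCS
  · linear_combination x 3 * hCS - S ^ 2 * x 3 * hu
      - u 3 * (u 0 * x 0 + u 1 * x 1 + u 2 * x 2 + u 3 * x 3) * hCS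
  · linear_combination S ^ 2 * x 4 * hu

/-- The Davis group: the group generated by the translations, along the lines through the center
`e₅`, that carry each side of the regular hyperbolic 120-cell with dihedral angle `2π/5` to the
opposite side. -/
def davisGroup : Subgroup SOPlus :=
  Subgroup.closure {g | ∃ u ∈ sideDirections, g.val.val = translation u (2 * inradius)}

/-! ### Space forms, isometries, and spin structures -/

/-- The orbit space `Γ \ H⁴`. -/
abbrev Manifold (Γ : Subgroup SOPlus) : Type := MulAction.orbitRel.Quotient Γ H4

/-- The quotient map `H⁴ → Γ \ H⁴`. -/
def toManifold (Γ : Subgroup SOPlus) (x : H4) : Manifold Γ := Quotient.mk'' x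

/-- An orientation-preserving isometry of `Γ \ H⁴`: a bijection that is given locally, in `H⁴`, by
orientation-preserving isometries of `H⁴`. -/
def IsOrientationPreservingIsometry {Γ : Subgroup SOPlus} (f : Manifold Γ → Manifold Γ) : Prop :=
  Function.Bijective f ∧
    ∀ x : H4, ∃ g : SOPlus, ∀ᶠ y in 𝓝 x, f (toManifold Γ y) = toManifold Γ (g • y)

/-- A spin structure `Γ̂ \ Spin⁺(4,1)` on `Γ \ H⁴`: a subgroup `Γ̂` of `Spin⁺(4,1)` that the double
covering `η` maps isomorphically onto `Γ`. -/
@[ext]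
structure SpinStructure (Γ : Subgroup SOPlus) where
  /-- The lift `Γ̂` of `Γ`. -/
  lift : Subgroup SU11H
  bijOn : Set.BijOn eta lift Γ

namespace SpinStructure

variable {Γ : Subgroup SOPlus} (S : SpinStructure Γ)

/-- The total space `Γ̂ \ Spin⁺(4,1)`. -/
abbrev Total : Type := MulAction.orbitRel.Quotient S.lift SU11H

/-- The quotient map `Spin⁺(4,1) → Γ̂ \ Spin⁺(4,1)`. -/
def toTotal (a : SU11H) : S.Total := Quotient.mk'' a

/-- The bundle projection `Γ̂ \ Spin⁺(4,1) → Γ \ H⁴`, `Γ̂ a ↦ Γ η(a) e₅`. -/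
def proj : S.Total → Manifold Γ :=
  Quotient.lift (fun a => toManifold Γ (eta a • basePoint)) (by
    rintro a b ⟨c, rfl⟩
    refine Quotient.sound ⟨⟨eta c, S.bijOn.mapsTo c.property⟩, ?_⟩
    change eta c • eta b • basePoint = eta (c * b) • basePoint
    rw [map_mul, mul_smul])

/-- A symmetry of the spin structure: a map `Γ̂ a ↦ Γ̂ h a` for an element `h` of the normalizer
of `Γ̂` in `Spin⁺(4,1)`. -/
def IsSymmetry (F : S.Total → S.Total) : Prop :=
  ∃ h ∈ Subgroup.normalizer (S.lift : Set SU11H), ∀ a : SU11H, F (S.toTotal a) = S.toTotal (h * a)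

/-- A spin structure is fully symmetric if every orientation-preserving isometry of the manifold
lifts to a symmetry of the spin structure. -/
def IsFullySymmetric : Prop :=
  ∀ f : Manifold Γ → Manifold Γ, IsOrientationPreservingIsometry f →
    ∃ F : S.Total → S.Total, S.IsSymmetry F ∧ ∀ p, S.proj (F p) = f (S.proj p)

end SpinStructure

end Davis

end

noncomputable section

namespace Davis

/-! The kernel of `eta` is `{1, -1}`, so a lift of the group is a consistent choice of sign for each
of its elements. Orientation-preserving isometries of the orbit space are induced by the normalizer
of the group (`IsOrientationPreservingIsometry.exists_mem_normalizer`). Hence a spin structure is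
fully symmetric exactly when its lift is normalized by every spin element over that normalizer; the
two directions are `SpinStructure.IsFullySymmetric.mem_normalizer` and
`SpinStructure.isFullySymmetric_of_forall`.

Existence is arithmetic. Each generating translation has one lift with diagonal entries `-cosh r =
-τ²`, and this lift is congruent to the identity modulo `sinh r`, in the algebraic integers with `2`
inverted. The lifts generate `davisLift`, all of whose elements have reduced trace congruent to `2`.
Since `sinh r ^ 4` is `5` times a unit, `4` is not congruent to `0`, so two elements of `davisLift`
never have opposite traces (`reTrace_ne_neg_reTrace`). Therefore `davisLift` maps injectively to the
group. As the trace is invariant under conjugation, no conjugation by an element over the normalizer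
can change a sign, and the spin structure is fully symmetric.

Uniqueness comes from a symmetry of the 120-cell of order five, with lift `symmetryLift`, written
`s` here. For each chosen generator lift `A` one has `(A * s) ^ 5 = 1` and `s ^ 5 = 1`. If a fully
symmetric lift contained `-A` instead of `A`, it would contain the product of the conjugates of `-A`
by `1, s, ..., s ^ 4`, which is `(-A * s) ^ 5 * s ^ (-5) = -1`; this is impossible. So all signs are
forced (`SpinStructure.IsFullySymmetric.davisLift_le`). -/

/-! ### The kernel and the surjectivity of the double covering -/

lemma eta_val (A : SU11H) : (eta A).val.val = etaMatrix A.val.val := rfl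

lemma SU11H_ext {A B : SU11H} (h : A.val.val = B.val.val) : A = B :=
  Subtype.ext (Units.ext h)

lemma SOPlus_ext {g h : SOPlus} (H : ∀ x : Fin 5 → ℝ, g.val.val *ᵥ x = h.val.val *ᵥ x) : g = h :=
  Subtype.ext (Units.ext (Matrix.ext_of_mulVec_single fun _ => H _))

lemma toHerm_basePoint : toHerm basePoint.val = 1 := by
  ext i j <;> fin_cases i <;> fin_cases j <;> simp [toHerm, basePoint]

/-- The kernel of the double covering consists of `1` and `-1`. -/
lemma eq_one_or_eq_neg_one_of_eta_eq_one {A : SU11H} (hA : eta A = 1) :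
    A.val.val = 1 ∨ A.val.val = -1 := by
  have key : ∀ x : Fin 5 → ℝ, A.val.val * toHerm x * A.val.valᴴ = toHerm x := by
    intro x
    rw [← toHerm_etaMatrix, ← eta_val, hA]
    congr 1
    exact Matrix.one_mulVec x
  obtain ⟨h1, -, h3⟩ := SU11H_entries A
  have h4 := SU11H_entries' A
  -- The base point corresponds to the identity matrix, so `A A^* = 1`. Its corner entry `|a|² +
  -- |b|² = 1`, against `|a|² - |b|² = 1`, forces `b = 0`.
  have k4 := congrFun (congrFun (key basePoint.val) 0) 0
  rw [toHerm_basePoint] at k4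
  -- For diagonal `A`, fixing the quaternion `1` gives `d = a`; fixing `i` and `j` then makes `a`
  -- commute with both, hence real.
  have k0 := congrFun (congrFun (key (Pi.single 0 1)) 0) 1
  have k1 := congrFun (congrFun (key (Pi.single 1 1)) 0) 1
  have k2 := congrFun (congrFun (key (Pi.single 2 1)) 0) 1
  have hM := Matrix.eta_fin_two A.val.val
  generalize A.val.val 0 0 = a at *
  generalize A.val.val 0 1 = b at *
  generalize A.val.val 1 0 = c at *
  generalize A.val.val 1 1 = d at *
  rw [hM] at k0 k1 k2 k4
  simp only [Quaternion.star_mul_self, Quaternion.self_mul_star] at h1 h3 h4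
  have hb : b = 0 := by
    simp [Matrix.mul_apply, Fin.sum_univ_two, Quaternion.self_mul_star] at k4
    have e1 := congrArg (fun q : ℍ[ℝ] => q.re) h4
    have e2 := congrArg (fun q : ℍ[ℝ] => q.re) k4
    simp only [Quaternion.re_sub, Quaternion.re_add, Quaternion.re_coe, Quaternion.re_one] at e1 e2
    exact Quaternion.normSq_eq_zero.mp (by linarith)
  subst hb
  have ha : Quaternion.normSq a = 1 := by
    have e1 := congrArg (fun q : ℍ[ℝ] => q.re) h4
    simpa using e1
  have hd : Quaternion.normSq d = 1 := by
    have e1 := congrArg (fun q : ℍ[ℝ] => q.re) h3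
    simpa using e1
  have hc : c = 0 := by
    have e1 := congrArg (fun q : ℍ[ℝ] => q.re) h1
    simp [ha] at e1
    exact e1
  subst hc
  have hdd : star d * d = 1 := by rw [Quaternion.star_mul_self, hd]; simp
  have expand : ∀ q : ℍ[ℝ], a * q * star d = q → a * q = q * d := by
    intro q h
    calc a * q = a * q * (star d * d) := by rw [hdd, mul_one]
      _ = q * d := by rw [← mul_assoc, h]
  simp [toHerm, Matrix.mul_apply, Fin.sum_univ_two] at k0 k1 k2
  replace k0 := expand _ k0
  replace k1 := expand _ k1
  replace k2 := expand _ k2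
  have hda : d = a := by
    ext
    · simpa using (congrArg (fun q : ℍ[ℝ] => q.re) k0).symm
    · simpa using (congrArg (fun q : ℍ[ℝ] => q.imI) k0).symm
    · simpa using (congrArg (fun q : ℍ[ℝ] => q.imJ) k0).symm
    · simpa using (congrArg (fun q : ℍ[ℝ] => q.imK) k0).symm
  subst hda
  have e1 := congrArg (fun q : ℍ[ℝ] => q.imK) k1
  have e2 := congrArg (fun q : ℍ[ℝ] => q.imJ) k1
  have e3 := congrArg (fun q : ℍ[ℝ] => q.imK) k2
  simp at e1 e2 e3
  have f1 : d.imI = 0 := by linarith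
  have f2 : d.imJ = 0 := by linarith
  have f3 : d.imK = 0 := by linarith
  rw [Quaternion.normSq_def', f1, f2, f3] at ha
  have : d.re = 1 ∨ d.re = -1 := by
    rw [← sq_eq_sq_iff_eq_or_eq_neg]; linarith
  rw [hM]
  rcases this with h | h
  · left
    have : d = 1 := by ext <;> simp [h, f1, f2, f3]
    rw [this, Matrix.one_fin_two]
  · right
    have : d = -1 := by ext <;> simp [h, f1, f2, f3]
    rw [this, Matrix.one_fin_two]
    simp

/-- The element `diag(p, w)` of `SU(1,1;ℍ)`, for unit quaternions `p` and `w`. -/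
def diagUnit (p w : ℍ[ℝ]) (hp : Quaternion.normSq p = 1) (hw : Quaternion.normSq w = 1) : SU11H :=
  SU11H.mk !![p, 0; 0, w]
    (by ext1 i j; fin_cases i <;> fin_cases j <;>
          simp [quatJ, Matrix.mul_apply, Fin.sum_univ_two, Quaternion.star_mul_self, hp, hw])
    (by ext1 i j; fin_cases i <;> fin_cases j <;>
          simp [quatJ, Matrix.mul_apply, Fin.sum_univ_two, Matrix.vecMul_diagonal,
            Quaternion.self_mul_star, hp, hw])

lemma diagUnit_val (p w : ℍ[ℝ]) (hp : Quaternion.normSq p = 1) (hw : Quaternion.normSq w = 1) :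
    (diagUnit p w hp hw).val.val = !![p, 0; 0, w] := rfl

/-- The nontrivial element of the kernel of the double covering. -/
def negOne : SU11H := diagUnit (-1) (-1) (by simp) (by simp)

lemma negOne_val : negOne.val.val = -1 := by
  rw [negOne, diagUnit_val, Matrix.one_fin_two]; simp

lemma negOne_mul_val (A : SU11H) : (negOne * A).val.val = -A.val.val := by
  change negOne.val.val * A.val.val = _
  rw [negOne_val, neg_one_mul]

lemma negOne_mul_comm (A : SU11H) : negOne * A = A * negOne := by
  apply SU11H_ext
  change negOne.val.val * A.val.val = A.val.val * negOne.val.val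
  rw [negOne_val, neg_one_mul, mul_neg_one]

lemma eta_negOne_mul (A : SU11H) : eta (negOne * A) = eta A := by
  apply SOPlus_ext
  intro x
  rw [eta_val, etaMatrix_mulVec, eta_val, etaMatrix_mulVec, negOne_mul_val]
  simp

lemma eq_or_eq_negOne_mul_of_eta_eq {A B : SU11H} (h : eta A = eta B) :
    A = B ∨ A = negOne * B := by
  have h1 : eta (A * B⁻¹) = 1 := by rw [map_mul, map_inv, h, mul_inv_cancel]
  rcases eq_one_or_eq_neg_one_of_eta_eq_one h1 with h | h
  · left
    exact mul_inv_eq_one.mp (SU11H_ext h)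
  · right
    exact mul_inv_eq_iff_eq_mul.mp (SU11H_ext (h.trans negOne_val.symm))

/-- The vector of `ℝ^{4,1}` with given quaternionic part and last coordinate. -/
def ofQuat (q : ℍ[ℝ]) (t : ℝ) : Fin 5 → ℝ := ![q.re, q.imI, q.imJ, q.imK, t]

@[simp] lemma quatPart_ofQuat (q : ℍ[ℝ]) (t : ℝ) : quatPart (ofQuat q t) = q := rfl

@[simp] lemma ofQuat_four (q : ℍ[ℝ]) (t : ℝ) : ofQuat q t 4 = t := rfl

lemma ofQuat_quatPart (x : Fin 5 → ℝ) : ofQuat (quatPart x) (x 4) = x := by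
  ext i; fin_cases i <;> rfl

lemma lorentz_eq_inner (x y : Fin 5 → ℝ) :
    lorentz x y = inner ℝ (quatPart x) (quatPart y) - x 4 * y 4 := by
  rw [lorentz_eq, Quaternion.inner_def]
  simp

lemma eta_diagUnit_mulVec (p w : ℍ[ℝ]) (hp : Quaternion.normSq p = 1)
    (hw : Quaternion.normSq w = 1) (x : Fin 5 → ℝ) :
    (eta (diagUnit p w hp hw)).val.val *ᵥ x = ofQuat (p * quatPart x * star w) (x 4) := by
  rw [eta_val, etaMatrix_mulVec, diagUnit_val]
  have h1 : p * (x 4 : ℍ[ℝ]) * star p = (x 4 : ℍ[ℝ]) := by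
    rw [← Quaternion.coe_commutes, mul_assoc, Quaternion.self_mul_star, hp]; simp
  have h2 : (!![p, 0; 0, w])ᴴ = !![star p, 0; 0, star w] := by
    ext1 i j; fin_cases i <;> fin_cases j <;> simp
  have h3 : toHerm x = !![(x 4 : ℍ[ℝ]), quatPart x; star (quatPart x), (x 4 : ℍ[ℝ])] := rfl
  rw [h2, h3, Matrix.mul_fin_two, Matrix.mul_fin_two]
  simp only [mul_zero, zero_mul, add_zero, zero_add, h1]
  rfl

/-- Orthogonal transformations of the quaternions are multiplications by unit quaternions on both
sides, composed with the conjugation if they reverse the orientation. -/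
lemma exists_unit_mul_mul (φ : ℍ[ℝ] ≃ₗᵢ[ℝ] ℍ[ℝ]) :
    ∃ p w : ℍ[ℝ], Quaternion.normSq p = 1 ∧ Quaternion.normSq w = 1 ∧
      ((∀ q, φ q = p * q * w) ∨ ∀ q, φ q = p * star q * w) := by
  -- Cartan–Dieudonné: hyperplane reflections generate the orthogonal group, and the two shapes are
  -- closed under products and inverses.
  have hφ : φ ∈ Subgroup.closure (Set.range fun v : ℍ[ℝ] => (ℝ ∙ v)ᗮ.reflection) := by
    rw [LinearIsometryEquiv.reflections_generate]; trivial
  induction hφ using Subgroup.closure_induction with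
  | mem ψ h =>
    obtain ⟨v, rfl⟩ := h
    rcases eq_or_ne v 0 with rfl | hv
    · exact ⟨1, 1, by simp, by simp, Or.inl fun q => by
        rw [Submodule.reflection_orthogonal_apply, Submodule.reflection_singleton_apply]; simp⟩
    · have hn : 0 < Quaternion.normSq v :=
        lt_of_le_of_ne Quaternion.normSq_nonneg (Ne.symm (Quaternion.normSq_ne_zero.mpr hv))
      obtain ⟨n, hn0, hnn⟩ : ∃ n : ℝ, n ≠ 0 ∧ n * n = Quaternion.normSq v :=
        ⟨√(Quaternion.normSq v), by positivity, Real.mul_self_sqrt hn.le⟩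
      have hu : Quaternion.normSq (n⁻¹ • v) = 1 := by
        rw [Quaternion.normSq_smul, ← hnn]; field_simp
      -- For a unit quaternion `u`, the identity `2⟨q, u⟩ = q ū + u q̄` turns the reflection `q -
      -- 2⟨q, u⟩ u` into `-u q̄ u`.
      refine ⟨-(n⁻¹ • v), n⁻¹ • v, by rw [Quaternion.normSq_neg, hu], hu, Or.inr fun q => ?_⟩
      have hi : ‖v‖ ^ 2 = (n⁻¹ * n⁻¹)⁻¹ := by
        rw [sq, ← Quaternion.normSq_eq_norm_mul_self, ← hnn]; field_simp
      have hm : (n⁻¹ * n⁻¹) * (v.re ^ 2 + v.imI ^ 2 + v.imJ ^ 2 + v.imK ^ 2) = 1 := by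
        rw [← Quaternion.normSq_def', ← hnn]; field_simp
      rw [Submodule.reflection_orthogonal_apply, Submodule.reflection_singleton_apply]
      simp only [two_nsmul, RCLike.ofReal_real_eq_id, id_eq, hi, div_inv_eq_mul, Quaternion.inner_def]
      ext <;> simp
      · linear_combination -q.re * hm
      · linear_combination -q.imI * hm
      · linear_combination -q.imJ * hm
      · linear_combination -q.imK * hm
  | one => exact ⟨1, 1, by simp, by simp, Or.inl fun q => by simp⟩
  | mul x y _ _ hx hy =>
    obtain ⟨p, w, hp, hw, h⟩ := hx
    obtain ⟨p', w', hp', hw', h'⟩ := hy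
    rcases h with h | h
    · refine ⟨p * p', w' * w, by simp [hp, hp'], by simp [hw, hw'], ?_⟩
      rcases h' with h' | h'
      · exact Or.inl fun q => by simp [h, h', mul_assoc]
      · exact Or.inr fun q => by simp [h, h', mul_assoc]
    · refine ⟨p * star w', star p' * w, by simp [hp, hw'], by simp [hw, hp'], ?_⟩
      rcases h' with h' | h'
      · exact Or.inr fun q => by simp [h, h', mul_assoc]
      · exact Or.inl fun q => by simp [h, h', mul_assoc]
  | inv x _ hx =>
    obtain ⟨p, w, hp, hw, h⟩ := hx
    have hp2 : p * star p = 1 := by rw [Quaternion.self_mul_star, hp]; simp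
    have hw2 : star w * w = 1 := by rw [Quaternion.star_mul_self, hw]; simp
    rcases h with h | h
    · refine ⟨star p, star w, by simp [hp], by simp [hw], Or.inl fun q => ?_⟩
      apply x.injective
      rw [LinearIsometryEquiv.coe_inv, x.apply_symm_apply, h]
      calc q = p * star p * q * (star w * w) := by rw [hp2, hw2, one_mul, mul_one]
        _ = p * (star p * q * star w) * w := by simp only [mul_assoc]
    · refine ⟨w, p, hw, hp, Or.inr fun q => ?_⟩
      apply x.injective
      rw [LinearIsometryEquiv.coe_inv, x.apply_symm_apply, h]
      calc q = p * star p * q * (star w * w) := by rw [hp2, hw2, one_mul, mul_one]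
        _ = p * star (w * star q * p) * w := by simp [mul_assoc]

/-- Since the base point is the identity matrix, a Hermitian `A` sends it to `A²`. The witness is
the Hermitian square root of `toHerm y`, with diagonal `x = √((y 4 + 1) / 2)` and off-diagonal entry
`quatPart y / (2x)`. -/
lemma exists_eta_smul_basePoint (y : H4) : ∃ A : SU11H, eta A • basePoint = y := by
  obtain ⟨y, hy, hy4⟩ := y
  obtain ⟨x, hx, hxx⟩ : ∃ x : ℝ, x ≠ 0 ∧ x * x = (y 4 + 1) / 2 :=
    ⟨√((y 4 + 1) / 2), by positivity, Real.mul_self_sqrt (by linarith)⟩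
  obtain ⟨z, hz⟩ : ∃ z : ℍ[ℝ], z = (2 * x)⁻¹ • quatPart y := ⟨_, rfl⟩
  have hq : Quaternion.normSq (quatPart y) = (y 4 + 1) * (y 4 - 1) := by
    rw [lorentz_eq] at hy
    simp only [Quaternion.normSq_def', quatPart_re, quatPart_imI, quatPart_imJ, quatPart_imK]
    linear_combination hy
  have hzn : Quaternion.normSq z = (y 4 - 1) / 2 := by
    rw [hz, Quaternion.normSq_smul, hq]
    have : (2 * x)⁻¹ ^ 2 = (2 * (y 4 + 1))⁻¹ := by
      rw [inv_pow, show (2 * x) ^ 2 = 4 * (x * x) by ring, hxx]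
      congr 1
      ring
    rw [this]
    have : y 4 + 1 ≠ 0 := by linarith
    field_simp
  have hzz : z * star z = (((y 4 - 1) / 2 : ℝ) : ℍ[ℝ]) := by rw [Quaternion.self_mul_star, hzn]
  have hzz' : star z * z = (((y 4 - 1) / 2 : ℝ) : ℍ[ℝ]) := by rw [Quaternion.star_mul_self, hzn]
  have hxxq : (x : ℍ[ℝ]) * (x : ℍ[ℝ]) = (((y 4 + 1) / 2 : ℝ) : ℍ[ℝ]) := by
    rw [← Quaternion.coe_mul, hxx]
  have hT : (!![(x : ℍ[ℝ]), z; star z, (x : ℍ[ℝ])])ᴴ = !![(x : ℍ[ℝ]), z; star z, (x : ℍ[ℝ])] := by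
    ext i j <;> fin_cases i <;> fin_cases j <;> simp
  have hm : !![(x : ℍ[ℝ]), z; star z, (x : ℍ[ℝ])] * quatJ * !![(x : ℍ[ℝ]), z; star z, (x : ℍ[ℝ])]
      = quatJ := by
    have hJ : quatJ = !![1, 0; 0, -1] := by
      ext1 i j; fin_cases i <;> fin_cases j <;> simp [quatJ]
    have h1 : (((y 4 + 1) / 2 : ℝ) : ℍ[ℝ]) - (((y 4 - 1) / 2 : ℝ) : ℍ[ℝ]) = 1 := by
      rw [← Quaternion.coe_sub, ← Quaternion.coe_one]; congr 1; ring
    have hxxq' := hxxq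
    generalize (((y 4 + 1) / 2 : ℝ) : ℍ[ℝ]) = α at h1 hxxq'
    generalize (((y 4 - 1) / 2 : ℝ) : ℍ[ℝ]) = γ at h1 hzz hzz'
    rw [hJ, Matrix.mul_fin_two, Matrix.mul_fin_two]
    ext1 i j
    fin_cases i <;> fin_cases j
    · simp [hxxq', hzz, ← sub_eq_add_neg, h1]
    · simp [Quaternion.coe_commutes x z]
    · simp [Quaternion.coe_commutes x (star z)]
    · simp only [Fin.mk_one, Matrix.of_apply, Matrix.cons_val', Matrix.cons_val_one,
        Matrix.cons_val_fin_one, mul_one, mul_zero, zero_add, add_zero, mul_neg, neg_mul, hxxq',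
        hzz']
      rw [← sub_eq_add_neg, ← neg_sub, h1]
  refine ⟨SU11H.mk _ (by rw [hT]; exact hm) (by rw [hT]; exact hm), Subtype.ext ?_⟩
  change etaMatrix !![(x : ℍ[ℝ]), z; star z, (x : ℍ[ℝ])] *ᵥ basePoint.val = y
  rw [etaMatrix_mulVec, hT, toHerm_basePoint, mul_one, Matrix.mul_fin_two]
  have h1 : (x : ℍ[ℝ]) * z + z * x = quatPart y := by
    rw [Quaternion.coe_commutes x z, ← two_mul, Quaternion.mul_coe_eq_smul, hz, smul_smul,
      two_mul, ← add_smul, show x * (2 * x)⁻¹ + x * (2 * x)⁻¹ = 1 by field_simp; norm_num,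
      one_smul]
  have h2 : (x : ℍ[ℝ]) * x + z * star z = ((y 4 : ℝ) : ℍ[ℝ]) := by
    rw [hxxq, hzz, ← Quaternion.coe_add]; congr 1; ring
  rw [h1, h2]
  exact ofQuat_quatPart y

/-- The double covering is surjective. -/
lemma eta_surjective : Function.Surjective eta := by
  have main : ∀ g : SOPlus, g • basePoint = basePoint → ∃ A : SU11H, eta A = g := by
    intro g hg
    obtain ⟨hL, hdet, -⟩ := g.property
    replace hg : g.val.val *ᵥ basePoint.val = basePoint.val := congrArg Subtype.val hg
    -- Fixing `e₅` and preserving the form leaves the last coordinate unchanged, so `g` is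
    -- determined by an isometry `f` of the quaternions.
    have hlast : ∀ x : Fin 5 → ℝ, (g.val.val *ᵥ x) 4 = x 4 := by
      intro x
      have h := lorentz_mulVec g.val.val hL x basePoint.val
      rw [hg] at h
      simp [lorentz_eq, basePoint] at h
      exact h
    let f : ℍ[ℝ] →ₗᵢ[ℝ] ℍ[ℝ] :=
      { toFun := fun q => quatPart (g.val.val *ᵥ ofQuat q 0)
        map_add' := fun p q => by
          have : ofQuat (p + q) 0 = ofQuat p 0 + ofQuat q 0 := by
            ext i; fin_cases i <;> simp [ofQuat]
          rw [this, Matrix.mulVec_add]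
          ext <;> simp
        map_smul' := fun r q => by
          have : ofQuat (r • q) 0 = r • ofQuat q 0 := by
            ext i; fin_cases i <;> simp [ofQuat]
          rw [this, Matrix.mulVec_smul]
          ext <;> simp
        norm_map' := fun q => by
          have h := lorentz_mulVec g.val.val hL (ofQuat q 0) (ofQuat q 0)
          rw [lorentz_eq_inner, lorentz_eq_inner, hlast] at h
          simp only [ofQuat_four, mul_zero, sub_zero, real_inner_self_eq_norm_sq,
            quatPart_ofQuat] at h
          exact (sq_eq_sq₀ (norm_nonneg _) (norm_nonneg _)).mp h }
    have hf : ∀ x : Fin 5 → ℝ, g.val.val *ᵥ x = ofQuat (f (quatPart x)) (x 4) := by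
      intro x
      have h1 : x = ofQuat (quatPart x) 0 + x 4 • basePoint.val := by
        ext i; fin_cases i <;> simp [ofQuat, basePoint]
      have h2 : quatPart (g.val.val *ᵥ x) = f (quatPart x) := by
        conv_lhs => rw [h1, Matrix.mulVec_add, Matrix.mulVec_smul, hg]
        ext <;> simp [f, basePoint]
      rw [← h2, ← hlast x, ofQuat_quatPart]
    obtain ⟨p, w, hp, hw, h⟩ := exists_unit_mul_mul (f.toLinearIsometryEquiv rfl)
    have hw' : Quaternion.normSq (star w) = 1 := by rw [Quaternion.normSq_star, hw]
    simp only [LinearIsometry.coe_toLinearIsometryEquiv] at h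
    refine ⟨diagUnit p (star w) hp hw', ?_⟩
    rcases h with h | h
    · apply SOPlus_ext
      intro x
      rw [eta_diagUnit_mulVec, hf, h, star_star]
    -- Quaternion conjugation has determinant `-1` on `ℝ^{4,1}`, so this shape contradicts `det g =
    -- 1`.
    · exfalso
      have hK : g.val.val = (eta (diagUnit p (star w) hp hw')).val.val
          * Matrix.diagonal ![1, -1, -1, -1, 1] := by
        apply Matrix.ext_of_mulVec_single
        intro i
        generalize (Pi.single i 1 : Fin 5 → ℝ) = x
        have h1 : quatPart (Matrix.diagonal ![1, -1, -1, -1, 1] *ᵥ x) = star (quatPart x) := by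
          ext <;> simp [Matrix.mulVec_diagonal]
        have h2 : (Matrix.diagonal ![1, -1, -1, -1, 1] *ᵥ x) 4 = x 4 := by
          simp [Matrix.mulVec_diagonal]
        rw [← Matrix.mulVec_mulVec, eta_diagUnit_mulVec, hf, h, h1, h2, star_star]
      have hd := congrArg Matrix.det hK
      rw [Matrix.det_mul, hdet, (eta _).property.2.1] at hd
      simp [Matrix.det_diagonal, Fin.prod_univ_five] at hd
      norm_num at hd
  intro g
  obtain ⟨A, hA⟩ := exists_eta_smul_basePoint (g • basePoint)
  obtain ⟨B, hB⟩ := main ((eta A)⁻¹ * g) (by rw [mul_smul, ← hA, inv_smul_smul])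
  exact ⟨A * B, by rw [map_mul, hB, mul_inv_cancel_left]⟩

/-! ### Isometries of an orbit space and the normalizer of its group -/

lemma toManifold_eq_iff {Γ : Subgroup SOPlus} {x y : H4} :
    toManifold Γ x = toManifold Γ y ↔ ∃ γ ∈ Γ, γ • y = x := by
  rw [toManifold, toManifold, Quotient.eq'']
  exact ⟨fun ⟨γ, h⟩ => ⟨γ, γ.property, h⟩, fun ⟨γ, hγ, h⟩ => ⟨⟨γ, hγ⟩, h⟩⟩

lemma toManifold_smul {Γ : Subgroup SOPlus} {γ : SOPlus} (hγ : γ ∈ Γ) (x : H4) :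
    toManifold Γ (γ • x) = toManifold Γ x :=
  toManifold_eq_iff.mpr ⟨γ, hγ, rfl⟩

lemma coe_smul (g : SOPlus) (x : H4) : (g • x).val = g.val.val *ᵥ x.val := rfl

/-- The hyperboloid is the graph of `√(1 + ‖q‖²)` over the quaternions. Connectedness lets one local
representative of an isometry serve everywhere. -/
instance : PreconnectedSpace H4 := by
  have hmem : ∀ q : ℍ[ℝ], ofQuat q √(1 + ‖q‖ ^ 2) ∈ H4 := by
    intro q
    refine ⟨?_, ?_⟩
    · rw [lorentz_eq_inner, quatPart_ofQuat, ofQuat_four, Real.mul_self_sqrt (by positivity),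
        real_inner_self_eq_norm_sq]
      ring
    · rw [ofQuat_four]; positivity
  have hc : Continuous fun q : ℍ[ℝ] => (⟨ofQuat q √(1 + ‖q‖ ^ 2), hmem q⟩ : H4) := by
    refine Continuous.subtype_mk ?_ _
    refine continuous_pi fun i => ?_
    fin_cases i
    · exact Quaternion.continuous_re
    · exact Quaternion.continuous_imI
    · exact Quaternion.continuous_imJ
    · exact Quaternion.continuous_imK
    · exact Real.continuous_sqrt.comp (by fun_prop)
  refine ⟨?_⟩
  have hs : Set.range (fun q : ℍ[ℝ] => (⟨ofQuat q √(1 + ‖q‖ ^ 2), hmem q⟩ : H4)) = Set.univ := by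
    refine Set.eq_univ_of_forall fun x => ⟨quatPart x.val, Subtype.ext ?_⟩
    obtain ⟨hx, hx4⟩ := x.property
    rw [lorentz_eq_inner, real_inner_self_eq_norm_sq] at hx
    have : √(1 + ‖quatPart x.val‖ ^ 2) = x.val 4 := by
      rw [show 1 + ‖quatPart x.val‖ ^ 2 = x.val 4 * x.val 4 by linarith]
      exact Real.sqrt_mul_self hx4.le
    change ofQuat _ _ = _
    rw [this, ofQuat_quatPart]
  rw [← hs]
  exact isPreconnected_range hc

/-- Elements of `SO⁺(4,1)` that induce the same map of an open set to the orbit space of a countable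
group differ by an element of the group. -/
lemma exists_eq_mul_of_eqOn_isOpen {Γ : Subgroup SOPlus} [Countable Γ] {U : Set H4} (hU : IsOpen U)
    (hne : U.Nonempty) {g h : SOPlus}
    (H : ∀ x ∈ U, toManifold Γ (g • x) = toManifold Γ (h • x)) : ∃ γ ∈ Γ, g = γ * h := by
  by_contra! hcon
  -- `V γ` is the subspace on which `g` and `γ h` agree. If they are never equal, all these
  -- subspaces are proper, hence null sets.
  let V : Γ → Submodule ℝ (Fin 5 → ℝ) := fun γ =>
    LinearMap.ker (Matrix.toLin' (g.val.val - (γ.val * h).val.val))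
  have hV : ∀ γ, MeasureTheory.volume (V γ : Set (Fin 5 → ℝ)) = 0 := by
    intro γ
    apply MeasureTheory.Measure.addHaar_submodule
    intro htop
    apply hcon γ γ.property
    apply SOPlus_ext
    intro x
    have hx : x ∈ V γ := by rw [htop]; trivial
    rw [LinearMap.mem_ker, Matrix.toLin'_apply, Matrix.sub_mulVec, sub_eq_zero] at hx
    exact hx
  obtain ⟨U', hU', rfl⟩ := isOpen_induced_iff.mp hU
  -- Radial projection `n` of the open cone `D` to `H4` pulls `U` back to a nonempty open set of
  -- `ℝ⁵`. Countably many null subspaces would cover it, which is impossible.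
  let n : (Fin 5 → ℝ) → (Fin 5 → ℝ) := fun x => (√(-lorentz x x))⁻¹ • x
  let D : Set (Fin 5 → ℝ) := {x | lorentz x x < 0 ∧ 0 < x 4}
  have hlc : Continuous fun x : Fin 5 → ℝ => lorentz x x := by
    simp only [lorentz_eq]
    fun_prop
  have hD : IsOpen D :=
    (isOpen_lt hlc continuous_const).inter (isOpen_lt continuous_const (continuous_apply 4))
  have hnc : ContinuousOn n D := by
    refine ContinuousOn.smul (f := fun x : Fin 5 → ℝ => (√(-lorentz x x))⁻¹)
      (ContinuousOn.inv₀ ?_ ?_) continuousOn_id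
    · exact (Real.continuous_sqrt.comp hlc.neg).continuousOn
    · rintro x ⟨hx, -⟩
      exact (Real.sqrt_pos.mpr (by linarith)).ne'
  have hnD : ∀ x ∈ D, n x ∈ H4 := by
    rintro x ⟨hx, hx4⟩
    have hp : 0 < √(-lorentz x x) := Real.sqrt_pos.mpr (by linarith)
    have hs : √(-lorentz x x) * √(-lorentz x x) = -lorentz x x :=
      Real.mul_self_sqrt (by linarith)
    refine ⟨?_, ?_⟩
    · have h1 : lorentz (n x) (n x) = (√(-lorentz x x))⁻¹ * (√(-lorentz x x))⁻¹ * lorentz x x := by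
        simp only [n, lorentz_eq, Pi.smul_apply, smul_eq_mul]
        ring
      rw [h1, ← mul_inv, hs, inv_neg, neg_mul, inv_mul_cancel₀ hx.ne]
    · simp only [n, Pi.smul_apply, smul_eq_mul]
      positivity
  have hW : IsOpen (D ∩ n ⁻¹' U') := hnc.isOpen_inter_preimage hD hU'
  have hWne : (D ∩ n ⁻¹' U').Nonempty := by
    obtain ⟨x, hx⟩ := hne
    refine ⟨x.val, ⟨by rw [x.property.1]; norm_num, x.property.2⟩, ?_⟩
    have : n x.val = x.val := by simp [n, x.property.1]
    rw [Set.mem_preimage, this]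
    exact hx
  have hsub : D ∩ n ⁻¹' U' ⊆ ⋃ γ, (V γ : Set (Fin 5 → ℝ)) := by
    rintro x ⟨hxD, hxU⟩
    obtain ⟨γ, hγ, e⟩ := toManifold_eq_iff.mp (H ⟨n x, hnD x hxD⟩ hxU)
    rw [← mul_smul] at e
    have e' := congrArg Subtype.val e
    rw [coe_smul, coe_smul] at e'
    simp only [n, Matrix.mulVec_smul] at e'
    have hp : (√(-lorentz x x))⁻¹ ≠ 0 := inv_ne_zero (Real.sqrt_pos.mpr (by linarith [hxD.1])).ne'
    refine Set.mem_iUnion.mpr ⟨⟨γ, hγ⟩, ?_⟩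
    change x ∈ LinearMap.ker _
    rw [LinearMap.mem_ker, Matrix.toLin'_apply, Matrix.sub_mulVec, sub_eq_zero]
    exact (smul_right_injective _ hp e').symm
  have h0 : MeasureTheory.volume (D ∩ n ⁻¹' U') = 0 :=
    MeasureTheory.measure_mono_null hsub (MeasureTheory.measure_iUnion_null hV)
  exact (hW.measure_pos MeasureTheory.volume hWne).ne' h0

lemma exists_eq_mul_of_forall {Γ : Subgroup SOPlus} [Countable Γ] {g h : SOPlus}
    (H : ∀ x, toManifold Γ (g • x) = toManifold Γ (h • x)) : ∃ γ ∈ Γ, g = γ * h :=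
  exists_eq_mul_of_eqOn_isOpen isOpen_univ ⟨basePoint, trivial⟩ fun x _ => H x

/-- An orientation-preserving isometry of the orbit space of a countable group is induced by an
element of the normalizer of the group. -/
lemma IsOrientationPreservingIsometry.exists_mem_normalizer {Γ : Subgroup SOPlus} [Countable Γ]
    {f : Manifold Γ → Manifold Γ} (hf : IsOrientationPreservingIsometry f) :
    ∃ g ∈ Subgroup.normalizer (Γ : Set SOPlus),
      ∀ x, f (toManifold Γ x) = toManifold Γ (g • x) := by
  obtain ⟨⟨hinj, -⟩, hloc⟩ := hf
  obtain ⟨g, hg⟩ := hloc basePoint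
  have hopen : IsOpen {x : H4 | ∀ᶠ y in 𝓝 x, f (toManifold Γ y) = toManifold Γ (g • y)} :=
    isOpen_setOfPred_eventually_nhds
  have hclosed : IsClosed {x : H4 | ∀ᶠ y in 𝓝 x, f (toManifold Γ y) = toManifold Γ (g • y)} := by
    refine isClosed_of_closure_subset fun x hx => ?_
    obtain ⟨g', hg'⟩ := hloc x
    obtain ⟨U, hU, hUo, hxU⟩ := mem_nhds_iff.mp hg'
    obtain ⟨z, hzU, hz⟩ := mem_closure_iff.mp hx U hUo hxU
    obtain ⟨V, hV, hVo, hzV⟩ := mem_nhds_iff.mp hz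
    -- Near `z` both `g` and `g'` represent `f`, so they differ by an element of `Γ`, which the
    -- orbit space does not see; `g` therefore represents `f` on all of `U`.
    obtain ⟨γ, hγ, rfl⟩ := exists_eq_mul_of_eqOn_isOpen (Γ := Γ) (hUo.inter hVo) ⟨z, hzU, hzV⟩
      (g := g) (h := g') fun y hy => (hV hy.2).symm.trans (hU hy.1)
    filter_upwards [hUo.mem_nhds hxU] with y hy
    rw [mul_smul, toManifold_smul hγ]
    exact hU hy
  have huniv := IsClopen.eq_univ ⟨hclosed, hopen⟩ ⟨basePoint, hg⟩
  have hglob : ∀ x, f (toManifold Γ x) = toManifold Γ (g • x) := fun x =>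
    (show x ∈ {x : H4 | ∀ᶠ y in 𝓝 x, f (toManifold Γ y) = toManifold Γ (g • y)} by
      rw [huniv]; trivial).self_of_nhds
  refine ⟨g, Subgroup.mem_normalizer_iff.mpr fun γ => ⟨fun hγ => ?_, fun hγ => ?_⟩, hglob⟩
  · obtain ⟨γ', hγ', e⟩ := exists_eq_mul_of_forall (Γ := Γ) (g := g * γ) (h := g) fun x => by
      rw [mul_smul, ← hglob, toManifold_smul hγ, hglob]
    rwa [e, mul_inv_cancel_right]
  -- This direction needs injectivity of `f`: if `g γ g⁻¹` lies in `Γ`, then `f` takes equal values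
  -- at the orbits of `γ x` and `x`.
  · obtain ⟨γ', hγ', e⟩ := exists_eq_mul_of_forall (Γ := Γ) (g := γ) (h := 1) fun x => by
      apply hinj
      rw [hglob, hglob, ← mul_smul, ← toManifold_smul hγ (g • (1 : SOPlus) • x), one_smul,
        ← mul_smul, inv_mul_cancel_right]
    rwa [e, mul_one]

/-- An element of the normalizer of a group induces an isometry of the orbit space. -/
lemma exists_isOrientationPreservingIsometry {Γ : Subgroup SOPlus} {g : SOPlus}
    (hg : g ∈ Subgroup.normalizer (Γ : Set SOPlus)) :
    ∃ f : Manifold Γ → Manifold Γ, IsOrientationPreservingIsometry f ∧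
      ∀ x, f (toManifold Γ x) = toManifold Γ (g • x) := by
  have hg' := Subgroup.mem_normalizer_iff.mp hg
  refine ⟨Quotient.lift (fun x => toManifold Γ (g • x)) ?_, ⟨⟨?_, ?_⟩, fun x => ⟨g, ?_⟩⟩,
    fun x => rfl⟩
  · rintro x y ⟨γ, rfl⟩
    refine toManifold_eq_iff.mpr ⟨g * γ * g⁻¹, (hg' γ).mp γ.property, ?_⟩
    change (g * γ.val * g⁻¹) • g • y = g • γ.val • y
    simp only [← mul_smul, inv_mul_cancel_right]
  · intro p q
    induction p using Quotient.inductionOn with | _ x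
    induction q using Quotient.inductionOn with | _ y
    intro h
    obtain ⟨γ, hγ, e⟩ := toManifold_eq_iff.mp h
    refine toManifold_eq_iff.mpr ⟨g⁻¹ * γ * g, ?_, ?_⟩
    · exact (Subgroup.mem_normalizer_iff''.mp hg γ).mp hγ
    · rw [mul_smul, mul_smul, e, inv_smul_smul]
  · intro p
    induction p using Quotient.inductionOn with | _ x
    refine ⟨toManifold Γ (g⁻¹ • x), ?_⟩
    change toManifold Γ (g • g⁻¹ • x) = toManifold Γ x
    rw [smul_inv_smul]
  · exact Filter.Eventually.of_forall fun y => rfl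

/-- For a spin structure on the orbit space of a countable group, an element of `Spin⁺(4,1)` over
the normalizer of the group induces an isometry; if it lifts to a symmetry, then the element
normalizes the lift of the group. -/
lemma SpinStructure.IsFullySymmetric.mem_normalizer {Γ : Subgroup SOPlus} [Countable Γ]
    {S : SpinStructure Γ} (hS : S.IsFullySymmetric) {a : SU11H}
    (ha : eta a ∈ Subgroup.normalizer (Γ : Set SOPlus)) :
    a ∈ Subgroup.normalizer (S.lift : Set SU11H) := by
  obtain ⟨f, hf, hfa⟩ := exists_isOrientationPreservingIsometry ha
  obtain ⟨F, ⟨h, hh, hF⟩, hproj⟩ := hS f hf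
  -- `eta a` and `eta h` induce the same isometry, so `a = ±c h` with `c` in the lift. The sign is
  -- central and does not affect normalizing.
  obtain ⟨γ, hγ, e⟩ := exists_eq_mul_of_forall (Γ := Γ) (g := eta a) (h := eta h) fun x => by
    obtain ⟨b, rfl⟩ := exists_eta_smul_basePoint x
    rw [← hfa]
    have := hproj (S.toTotal b)
    rw [hF] at this
    refine this.symm.trans ?_
    change toManifold Γ (eta (h * b) • basePoint) = _
    rw [map_mul, mul_smul]
  obtain ⟨c, hc, rfl⟩ := S.bijOn.surjOn hγ
  rw [← map_mul] at e
  have hch : c * h ∈ Subgroup.normalizer (S.lift : Set SU11H) :=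
    mul_mem (Subgroup.le_normalizer hc) hh
  rcases eq_or_eq_negOne_mul_of_eta_eq e with rfl | rfl
  · exact hch
  · have hconj : ∀ b : SU11H, negOne * (c * h) * b * (negOne * (c * h))⁻¹
        = (c * h) * b * (c * h)⁻¹ := by
      intro b
      rw [mul_inv_rev, negOne_mul_comm, mul_assoc _ negOne, negOne_mul_comm]
      simp only [mul_assoc]
      rw [negOne_mul_comm]
      simp only [mul_assoc, inv_mul_cancel, mul_one]
    rw [Subgroup.mem_normalizer_iff] at hch ⊢
    intro b
    rw [hconj]
    exact hch b

/-- A spin structure is fully symmetric if its lift is normalized by all elements of `Spin⁺(4,1)`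
over the normalizer of the group. -/
lemma SpinStructure.isFullySymmetric_of_forall {Γ : Subgroup SOPlus} [Countable Γ]
    {S : SpinStructure Γ} (hS : ∀ a : SU11H, eta a ∈ Subgroup.normalizer (Γ : Set SOPlus) →
      a ∈ Subgroup.normalizer (S.lift : Set SU11H)) : S.IsFullySymmetric := by
  intro f hf
  obtain ⟨g, hg, hfg⟩ := hf.exists_mem_normalizer
  obtain ⟨a, rfl⟩ := eta_surjective g
  have ha := hS a hg
  refine ⟨Quotient.lift (fun b => S.toTotal (a * b)) ?_, ⟨a, ha, fun b => rfl⟩, fun p => ?_⟩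
  · rintro b b' ⟨c, rfl⟩
    refine Quotient.sound ⟨⟨a * c * a⁻¹, (Subgroup.mem_normalizer_iff.mp ha c).mp c.property⟩, ?_⟩
    change a * c.val * a⁻¹ * (a * b') = a * (c.val * b')
    simp only [mul_assoc, inv_mul_cancel_left]
  · induction p using Quotient.inductionOn with | _ b
    change toManifold Γ (eta (a * b) • basePoint) = f (toManifold Γ (eta b • basePoint))
    rw [hfg, map_mul, mul_smul]

/-! ### Countability of the Davis group and values at the inradius -/

/-- Countability takes the place of discreteness in the passage from isometries to the normalizer,
through the covering by null sets in `exists_eq_mul_of_eqOn_isOpen`. -/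
instance : Countable davisGroup := by
  have hs : sideDirections.Countable := by
    let W : Set (Fin 4 → ℝ) := {![2, 0, 0, 0], ![1, 1, 1, 1],
      ![0, 1, Real.goldenRatio, Real.goldenRatio⁻¹]}
    have hW : Countable W := (Set.toFinite W).countable
    refine (Set.countable_range fun x : W × Equiv.Perm (Fin 4) × (Fin 4 → ℤˣ) =>
      fun i => ((x.2.2 i : ℤ) : ℝ) * x.1.val (x.2.1 i) / 2).mono ?_
    rintro u ⟨w, hw, p, -, ε, h⟩
    exact ⟨(⟨w, hw⟩, p, ε), funext fun i => (h i).symm⟩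
  have hg : {g : SOPlus | ∃ u ∈ sideDirections,
      g.val.val = translation u (2 * inradius)}.Countable := by
    have : {g : SOPlus | ∃ u ∈ sideDirections, g.val.val = translation u (2 * inradius)} =
        (fun g : SOPlus => g.val.val) ⁻¹' ((translation · (2 * inradius)) '' sideDirections) := by
      ext g; simp [eq_comm]
    rw [this]
    exact (hs.image _).preimage fun g h e => Subtype.ext (Units.ext e)
  have := hg.to_subtype
  rw [davisGroup, FreeGroup.closure_eq_range]
  exact (Set.countable_range _).to_subtype

lemma cosh_inradius : Real.cosh inradius = Real.goldenRatio ^ 2 :=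
  Real.cosh_arcosh (by nlinarith [Real.one_lt_goldenRatio])

lemma sinh_inradius_sq : Real.sinh inradius ^ 2 = 3 * Real.goldenRatio + 1 := by
  rw [Real.sinh_sq, cosh_inradius]
  linear_combination (Real.goldenRatio ^ 2 + Real.goldenRatio + 2) * Real.goldenRatio_sq

lemma isIntegral_goldenRatio : IsIntegral ℤ Real.goldenRatio := by
  refine ⟨Polynomial.X ^ 2 - Polynomial.X - 1, by monicity!, ?_⟩
  simp [Real.goldenRatio_sq]

/-! ### A congruence subgroup of the spin group -/

/-- The multiples of `sinh r` in the ring of algebraic integers with `2` inverted, where `r` is the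
inradius of the 120-cell. The fourth power of `sinh r` is `5` times a unit. -/
def sinhMultiples : AddSubgroup ℝ where
  carrier := {x | ∃ k : ℕ, ∃ y : ℝ, IsIntegral ℤ y ∧ 2 ^ k * x = Real.sinh inradius * y}
  zero_mem' := ⟨0, 0, isIntegral_zero, by simp⟩
  add_mem' := by
    rintro x x' ⟨k, y, hy, h⟩ ⟨l, z, hz, h'⟩
    have h2 : IsIntegral ℤ (2 : ℝ) := isIntegral_algebraMap (x := (2 : ℤ))
    refine ⟨k + l, 2 ^ l * y + 2 ^ k * z, ((h2.pow l).mul hy).add ((h2.pow k).mul hz), ?_⟩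
    linear_combination 2 ^ l * h + 2 ^ k * h'
  neg_mem' := by
    rintro x ⟨k, y, hy, h⟩
    exact ⟨k, -y, hy.neg, by linear_combination -h⟩

lemma isIntegral_sinh_inradius : IsIntegral ℤ (Real.sinh inradius) := by
  refine IsIntegral.of_pow (n := 2) (by norm_num) ?_
  rw [sinh_inradius_sq]
  exact ((isIntegral_algebraMap (x := (3 : ℤ))).mul isIntegral_goldenRatio).add isIntegral_one

lemma mul_mem_sinhMultiples {x y : ℝ} (hx : x ∈ sinhMultiples) (hy : y ∈ sinhMultiples) :
    x * y ∈ sinhMultiples := by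
  obtain ⟨k, z, hz, h⟩ := hx
  obtain ⟨l, w, hw, h'⟩ := hy
  refine ⟨k + l, Real.sinh inradius * z * w, (isIntegral_sinh_inradius.mul hz).mul hw, ?_⟩
  calc 2 ^ (k + l) * (x * y) = (2 ^ k * x) * (2 ^ l * y) := by ring
    _ = _ := by rw [h, h']; ring

/-- With `S = sinh r`, `S⁴ = 5 (S² + 1)`. Taking fourth powers in `2 ^ k * 2 ^ n = S y` shows that
`2 ^ (4(k+n)) / 5` is an algebraic integer; being rational, it would be an integer. -/
lemma two_pow_notMem_sinhMultiples (n : ℕ) : (2 : ℝ) ^ n ∉ sinhMultiples := by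
  rintro ⟨k, y, hy, h⟩
  have hS := sinh_inradius_sq
  have hφ := Real.goldenRatio_sq
  have hz : IsIntegral ℤ ((Real.sinh inradius ^ 2 + 1) * y ^ 4) :=
    ((isIntegral_sinh_inradius.pow 2).add isIntegral_one).mul (hy.pow 4)
  have e : (Real.sinh inradius ^ 2 + 1) * y ^ 4
      = algebraMap ℚ ℝ ((2 : ℚ) ^ (4 * (k + n)) / 5) := by
    have h4 : Real.sinh inradius ^ 4 = 5 * (Real.sinh inradius ^ 2 + 1) := by
      rw [show Real.sinh inradius ^ 4 = (Real.sinh inradius ^ 2) ^ 2 by ring, hS]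
      linear_combination 9 * hφ
    have h1 : (2 : ℝ) ^ (4 * (k + n)) = 5 * ((Real.sinh inradius ^ 2 + 1) * y ^ 4) := by
      calc (2 : ℝ) ^ (4 * (k + n)) = (2 ^ k * 2 ^ n) ^ 4 := by ring
        _ = _ := by rw [h]; linear_combination y ^ 4 * h4
    simp only [eq_ratCast, Rat.cast_div, Rat.cast_pow, Rat.cast_ofNat]
    rw [h1]
    ring
  rw [e, isIntegral_algebraMap_iff (algebraMap ℚ ℝ).injective] at hz
  obtain ⟨m, hm⟩ := IsIntegrallyClosed.isIntegral_iff.mp hz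
  have h5 : (5 * m : ℤ) = 2 ^ (4 * (k + n)) := by
    have : (5 * m : ℚ) = 2 ^ (4 * (k + n)) := by
      simp only [algebraMap_int_eq, eq_intCast] at hm
      rw [hm]
      field_simp
    exact_mod_cast this
  have h6 : ((5 : ℕ) : ℤ) ∣ 2 := Int.Prime.dvd_pow' (by norm_num) ⟨m, h5.symm⟩
  norm_num at h6

/-- The quaternions with coordinates in `sinhMultiples`. -/
def quatSinhMultiples : AddSubgroup ℍ[ℝ] where
  carrier := {q | q.re ∈ sinhMultiples ∧ q.imI ∈ sinhMultiples ∧ q.imJ ∈ sinhMultiples ∧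
    q.imK ∈ sinhMultiples}
  zero_mem' := ⟨zero_mem _, zero_mem _, zero_mem _, zero_mem _⟩
  add_mem' := by
    rintro p q ⟨h0, h1, h2, h3⟩ ⟨k0, k1, k2, k3⟩
    exact ⟨add_mem h0 k0, add_mem h1 k1, add_mem h2 k2, add_mem h3 k3⟩
  neg_mem' := by
    rintro p ⟨h0, h1, h2, h3⟩
    exact ⟨neg_mem h0, neg_mem h1, neg_mem h2, neg_mem h3⟩

lemma mul_mem_quatSinhMultiples {p q : ℍ[ℝ]} (hp : p ∈ quatSinhMultiples)
    (hq : q ∈ quatSinhMultiples) : p * q ∈ quatSinhMultiples := by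
  obtain ⟨h0, h1, h2, h3⟩ := hp
  obtain ⟨k0, k1, k2, k3⟩ := hq
  have m {x y : ℝ} := @mul_mem_sinhMultiples x y
  refine ⟨?_, ?_, ?_, ?_⟩
  · rw [Quaternion.re_mul]
    exact sub_mem (sub_mem (sub_mem (m h0 k0) (m h1 k1)) (m h2 k2)) (m h3 k3)
  · rw [Quaternion.imI_mul]
    exact sub_mem (add_mem (add_mem (m h0 k1) (m h1 k0)) (m h2 k3)) (m h3 k2)
  · rw [Quaternion.imJ_mul]
    exact add_mem (add_mem (sub_mem (m h0 k2) (m h1 k3)) (m h2 k0)) (m h3 k1)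
  · rw [Quaternion.imK_mul]
    exact add_mem (sub_mem (add_mem (m h0 k3) (m h1 k2)) (m h2 k1)) (m h3 k0)

lemma star_mem_quatSinhMultiples {q : ℍ[ℝ]} (hq : q ∈ quatSinhMultiples) :
    star q ∈ quatSinhMultiples := by
  obtain ⟨h0, h1, h2, h3⟩ := hq
  exact ⟨by simpa using h0, by simpa using h1, by simpa using h2, by simpa using h3⟩

lemma SU11H_inv_val (A : SU11H) : (A⁻¹).val.val = quatJ * A.val.valᴴ * quatJ := by
  have hA : A.val.valᴴ * quatJ * A.val.val = quatJ := A.property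
  have h1 : (quatJ * A.val.valᴴ * quatJ) * A.val.val = 1 := by
    rw [Matrix.mul_assoc, Matrix.mul_assoc, ← Matrix.mul_assoc _ quatJ, hA, quatJ_mul_self]
  exact (Units.eq_inv_of_mul_eq_one_right h1).symm

/-- The matrices in `SU(1,1;ℍ)` that are congruent to the identity matrix. -/
def congruenceSubgroup : Subgroup SU11H where
  carrier := {A | ∀ i j, (A.val.val - 1) i j ∈ quatSinhMultiples}
  one_mem' := by
    intro i j
    have : (1 : SU11H).val.val - 1 = 0 := sub_self _
    rw [this]
    exact zero_mem _
  mul_mem' := by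
    intro A B hA hB i j
    -- In this form only products of two multiples of `sinh r` occur, so closure of `sinhMultiples`
    -- under products suffices and no ambient ring is needed.
    have : (A * B).val.val - 1
        = (A.val.val - 1) * (B.val.val - 1) + (A.val.val - 1) + (B.val.val - 1) := by
      change A.val.val * B.val.val - 1 = _
      noncomm_ring
    rw [this, Matrix.add_apply, Matrix.add_apply, Matrix.mul_apply, Fin.sum_univ_two]
    exact add_mem (add_mem (add_mem (mul_mem_quatSinhMultiples (hA _ _) (hB _ _))
      (mul_mem_quatSinhMultiples (hA _ _) (hB _ _))) (hA _ _)) (hB _ _)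
  inv_mem' := by
    intro A hA i j
    have : (A⁻¹).val.val - 1 = quatJ * (A.val.val - 1)ᴴ * quatJ := by
      rw [SU11H_inv_val, Matrix.conjTranspose_sub, Matrix.mul_sub, Matrix.sub_mul,
        Matrix.conjTranspose_one, Matrix.mul_one, quatJ_mul_self]
    rw [this, quatJ, Matrix.mul_diagonal, Matrix.diagonal_mul, Matrix.conjTranspose_apply]
    have h := star_mem_quatSinhMultiples (hA j i)
    fin_cases i <;> fin_cases j <;> simpa [-star_sub] using h

/-- The reduced trace. -/
def reTrace (A : SU11H) : ℝ := (A.val.val 0 0).re + (A.val.val 1 1).re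

lemma reTrace_mul_comm (A B : SU11H) : reTrace (A * B) = reTrace (B * A) := by
  change ((A.val.val * B.val.val) 0 0).re + ((A.val.val * B.val.val) 1 1).re
    = ((B.val.val * A.val.val) 0 0).re + ((B.val.val * A.val.val) 1 1).re
  simp only [Matrix.mul_apply, Fin.sum_univ_two, Quaternion.re_add, Quaternion.re_mul]
  ring

lemma reTrace_negOne_mul (A : SU11H) : reTrace (negOne * A) = -reTrace A := by
  simp only [reTrace, negOne_mul_val, Matrix.neg_apply, Quaternion.re_neg]
  ring

lemma reTrace_sub_two_mem {A : SU11H} (hA : A ∈ congruenceSubgroup) :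
    reTrace A - 2 ∈ sinhMultiples := by
  have h := add_mem (hA 0 0).1 (hA 1 1).1
  simp only [Matrix.sub_apply, Matrix.one_apply_eq, Quaternion.re_sub, Quaternion.re_one] at h
  convert h using 1
  rw [reTrace]
  ring

/-- Both traces are congruent to `2`, so opposite traces would make `4 = 2 ^ 2` a multiple of `sinh
r`. This is the invariant that detects signs, even after conjugation by elements that need not
preserve the congruence subgroup. -/
lemma reTrace_ne_neg_reTrace {A B : SU11H} (hA : A ∈ congruenceSubgroup)
    (hB : B ∈ congruenceSubgroup) : reTrace A ≠ -reTrace B := by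
  intro h
  apply two_pow_notMem_sinhMultiples 2
  have := neg_mem (add_mem (reTrace_sub_two_mem hA) (reTrace_sub_two_mem hB))
  rw [h] at this
  convert this using 1
  ring

/-! ### The lift of the Davis group -/

/-- A vector of `ℝ⁴` as a quaternion. -/
def toQuat (u : Fin 4 → ℝ) : ℍ[ℝ] := ⟨u 0, u 1, u 2, u 3⟩

@[simp] lemma toQuat_re (u : Fin 4 → ℝ) : (toQuat u).re = u 0 := rfl
@[simp] lemma toQuat_imI (u : Fin 4 → ℝ) : (toQuat u).imI = u 1 := rfl
@[simp] lemma toQuat_imJ (u : Fin 4 → ℝ) : (toQuat u).imJ = u 2 := rfl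
@[simp] lemma toQuat_imK (u : Fin 4 → ℝ) : (toQuat u).imK = u 3 := rfl

/-- The lift, to the spin group, of the hyperbolic translation by twice the inradius of the 120-cell
in the direction of a unit quaternion, that is congruent to the identity matrix if the direction is
that of a side. -/
def translationLift (q : ℍ[ℝ]) : Matrix (Fin 2) (Fin 2) ℍ[ℝ] :=
  !![((-Real.cosh inradius : ℝ) : ℍ[ℝ]), -Real.sinh inradius • q;
    -Real.sinh inradius • star q, ((-Real.cosh inradius : ℝ) : ℍ[ℝ])]

lemma translationLift_conjTranspose (q : ℍ[ℝ]) : (translationLift q)ᴴ = translationLift q := by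
  ext i j <;> fin_cases i <;> fin_cases j <;> simp [translationLift]

lemma translationLift_mul (q : ℍ[ℝ]) (hq : Quaternion.normSq q = 1) :
    translationLift q * quatJ * translationLift q = quatJ := by
  have h := Real.cosh_sq inradius
  rw [Quaternion.normSq_def'] at hq
  rw [translationLift]
  generalize Real.cosh inradius = C at *
  generalize Real.sinh inradius = S at *
  ext i j <;> fin_cases i <;> fin_cases j <;>
    simp [quatJ, Matrix.mul_apply, Fin.sum_univ_two, Matrix.vecMul_diagonal] <;>
    first
      | ring1
      | (right; ring1)
      | linear_combination h - S ^ 2 * hq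
      | linear_combination -h + S ^ 2 * hq

lemma exists_eta_translationLift (u : Fin 4 → ℝ)
    (hu : u 0 ^ 2 + u 1 ^ 2 + u 2 ^ 2 + u 3 ^ 2 = 1) :
    ∃ A : SU11H, A.val.val = translationLift (toQuat u) ∧
      (eta A).val.val = translation u (2 * inradius) := by
  have hm := translationLift_mul (toQuat u) (by simpa [Quaternion.normSq_def'] using hu)
  have hT := translationLift_conjTranspose (toQuat u)
  refine ⟨SU11H.mk (translationLift (toQuat u)) (by rw [hT]; exact hm) (by rw [hT]; exact hm), rfl, ?_⟩
  change etaMatrix (translationLift (toQuat u)) = _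
  apply Matrix.ext_of_mulVec_single
  intro k
  generalize (Pi.single k (1 : ℝ) : Fin 5 → ℝ) = x
  rw [etaMatrix_mulVec, hT, translation_mulVec, Real.cosh_two_mul, Real.sinh_two_mul,
    translationLift]
  have hCS := Real.cosh_sq inradius
  generalize Real.cosh inradius = C at *
  generalize Real.sinh inradius = S at *
  ext i
  fin_cases i <;>
    simp [ofHerm, toHerm, Matrix.mul_apply, Fin.sum_univ_two]
  · linear_combination x 0 * hCS - S ^ 2 * x 0 * hu
      - u 0 * (u 0 * x 0 + u 1 * x 1 + u 2 * x 2 + u 3 * x 3) * hCS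
  · linear_combination x 1 * hCS - S ^ 2 * x 1 * hu
      - u 1 * (u 0 * x 0 + u 1 * x 1 + u 2 * x 2 + u 3 * x 3) * hCS
  · linear_combination x 2 * hCS - S ^ 2 * x 2 * hu
      - u 2 * (u 0 * x 0 + u 1 * x 1 + u 2 * x 2 + u 3 * x 3) * hCS
  · linear_combination x 3 * hCS - S ^ 2 * x 3 * hu
      - u 3 * (u 0 * x 0 + u 1 * x 1 + u 2 * x 2 + u 3 * x 3) * hCS
  · linear_combination S ^ 2 * x 4 * hu

/-! ### The directions of the sides -/

lemma sideDirections_norm {u : Fin 4 → ℝ} (hu : u ∈ sideDirections) :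
    u 0 ^ 2 + u 1 ^ 2 + u 2 ^ 2 + u 3 ^ 2 = 1 := by
  obtain ⟨w, hw, p, -, ε, h⟩ := hu
  have h1 : ∀ i, u i ^ 2 = w (p i) ^ 2 / 4 := by
    intro i
    have hε : (((ε i : ℤ) : ℝ)) ^ 2 = 1 := by
      rcases Int.units_eq_one_or (ε i) with e | e <;> simp [e]
    rw [h i]
    linear_combination w (p i) ^ 2 / 4 * hε
  have h2 : u 0 ^ 2 + u 1 ^ 2 + u 2 ^ 2 + u 3 ^ 2 = ∑ i, w i ^ 2 / 4 := by
    rw [← Equiv.sum_comp p, Fin.sum_univ_four, h1, h1, h1, h1]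
  have hφ := Real.goldenRatio_sq
  have hi : Real.goldenRatio⁻¹ = Real.goldenRatio - 1 := by
    rw [Real.inv_goldenRatio]; linarith [Real.goldenRatio_add_goldenConj]
  rw [h2, Fin.sum_univ_four]
  rcases hw with rfl | rfl | rfl
  · simp only [Matrix.cons_val]; norm_num
  · simp only [Matrix.cons_val]; norm_num
  · simp only [hi, Matrix.cons_val]
    linear_combination hφ / 2

/-- The number `a + b τ`, where `τ` is the golden ratio. -/
def goldenVal (z : ℤ × ℤ) : ℝ := z.1 + z.2 * Real.goldenRatio

lemma goldenVal_add (z w : ℤ × ℤ) : goldenVal (z + w) = goldenVal z + goldenVal w := by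
  simp only [goldenVal, Prod.fst_add, Prod.snd_add]; push_cast; ring

lemma goldenVal_neg (z : ℤ × ℤ) : goldenVal (-z) = -goldenVal z := by
  simp only [goldenVal, Prod.fst_neg, Prod.snd_neg]; push_cast; ring

lemma isIntegral_goldenVal (z : ℤ × ℤ) : IsIntegral ℤ (goldenVal z) :=
  isIntegral_algebraMap.add (isIntegral_algebraMap.mul isIntegral_goldenRatio)

/-- Multiplication by the golden ratio. -/
def goldenMul (z : ℤ × ℤ) : ℤ × ℤ := (z.2, z.1 + z.2)

lemma goldenVal_goldenMul (z : ℤ × ℤ) :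
    goldenVal (goldenMul z) = Real.goldenRatio * goldenVal z := by
  simp only [goldenVal, goldenMul]
  push_cast
  linear_combination -(z.2 : ℝ) * Real.goldenRatio_sq

/-- The doubles of the directions of the sides, up to signs. -/
def sideCodes : List (Fin 4 → ℤ × ℤ) :=
  [![(2, 0), 0, 0, 0], ![0, (2, 0), 0, 0], ![0, 0, (2, 0), 0], ![0, 0, 0, (2, 0)],
    ![(1, 0), (1, 0), (1, 0), (1, 0)],
    ![0, (1, 0), (0, 1), (-1, 1)], ![0, (0, 1), (-1, 1), (1, 0)], ![0, (-1, 1), (1, 0), (0, 1)],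
    ![(1, 0), 0, (-1, 1), (0, 1)], ![(1, 0), (-1, 1), (0, 1), 0], ![(1, 0), (0, 1), 0, (-1, 1)],
    ![(0, 1), 0, (1, 0), (-1, 1)], ![(0, 1), (1, 0), (-1, 1), 0], ![(0, 1), (-1, 1), 0, (1, 0)],
    ![(-1, 1), 0, (0, 1), (1, 0)], ![(-1, 1), (0, 1), (1, 0), 0], ![(-1, 1), (1, 0), 0, (0, 1)]]

/-- Representatives of the doubles of the directions of the sides. -/
def baseCodes : List (Fin 4 → ℤ × ℤ) :=
  [![(2, 0), 0, 0, 0], ![(1, 0), (1, 0), (1, 0), (1, 0)], ![0, (1, 0), (0, 1), (-1, 1)]]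

/-- With `τ⁻¹ = τ - 1` all coordinates lie in `ℤ[τ]`. Coding them by integer pairs makes the
combinatorics of the 120 directions decidable. -/
lemma baseCodes_comp_mem : ∀ w ∈ baseCodes, ∀ p : Equiv.Perm (Fin 4),
    Equiv.Perm.sign p = 1 → (fun i => w (p i)) ∈ sideCodes := by
  decide +kernel

lemma exists_baseCodes_comp : ∀ v ∈ sideCodes, ∃ w ∈ baseCodes,
    ∃ p : Equiv.Perm (Fin 4), Equiv.Perm.sign p = 1 ∧ ∀ i, v i = w (p i) := by
  decide +kernel

lemma mem_sideDirections_iff {u : Fin 4 → ℝ} : u ∈ sideDirections ↔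
    ∃ v ∈ sideCodes, ∃ ε : Fin 4 → ℤˣ, ∀ i, 2 * u i = ((ε i : ℤ) : ℝ) * goldenVal (v i) := by
  have hi : Real.goldenRatio⁻¹ = Real.goldenRatio - 1 := by
    rw [Real.inv_goldenRatio]; linarith [Real.goldenRatio_add_goldenConj]
  constructor
  · rintro ⟨w, hw, p, hp, ε, h⟩
    obtain ⟨w', hw', e⟩ : ∃ w' ∈ baseCodes, ∀ i, w i = goldenVal (w' i) := by
      rcases hw with rfl | rfl | rfl
      · exact ⟨_, List.mem_cons_self, fun i => by fin_cases i <;> simp [goldenVal]⟩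
      · exact ⟨_, List.mem_cons_of_mem _ List.mem_cons_self,
          fun i => by fin_cases i <;> simp [goldenVal]⟩
      · refine ⟨_, List.mem_cons_of_mem _ (List.mem_cons_of_mem _ List.mem_cons_self), fun i => ?_⟩
        fin_cases i <;> simp [goldenVal, hi]
        ring
    refine ⟨_, baseCodes_comp_mem w' hw' p (Equiv.Perm.mem_alternatingGroup.mp hp), ε, fun i => ?_⟩
    rw [h i, e]
    ring
  · rintro ⟨v, hv, ε, h⟩
    obtain ⟨w, hw, p, hp, e⟩ := exists_baseCodes_comp v hv
    refine ⟨fun i => goldenVal (w i), ?_, p, Equiv.Perm.mem_alternatingGroup.mpr hp, ε, fun i => ?_⟩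
    · simp only [baseCodes, List.mem_cons, List.not_mem_nil, or_false] at hw
      rcases hw with rfl | rfl | rfl
      · left; ext i; fin_cases i <;> simp [goldenVal]
      · right; left; ext i; fin_cases i <;> simp [goldenVal]
      · right; right; ext i
        fin_cases i <;> simp [goldenVal, hi]
        ring
    · simp only [← e]
      linear_combination h i / 2

lemma isIntegral_two_mul_of_mem {u : Fin 4 → ℝ} (hu : u ∈ sideDirections) (i : Fin 4) :
    IsIntegral ℤ (2 * u i) := by
  obtain ⟨v, -, ε, h⟩ := mem_sideDirections_iff.mp hu
  rw [h i]
  exact isIntegral_algebraMap.mul (isIntegral_goldenVal _)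

/-! ### A symmetry of order five of the 120-cell -/

/-- A unit quaternion of order five with real part `-τ / 2`, where `τ` is the golden ratio. -/
def orderFive : ℍ[ℝ] := ⟨-Real.goldenRatio / 2, 1 / 2, (Real.goldenRatio - 1) / 2, 0⟩

lemma normSq_orderFive : Quaternion.normSq orderFive = 1 := by
  rw [Quaternion.normSq_def']
  simp only [orderFive]
  linear_combination Real.goldenRatio_sq / 2

lemma orderFive_mul_self : orderFive * orderFive = -Real.goldenRatio • orderFive - 1 := by
  have h := Real.goldenRatio_sq
  ext <;> simp <;> simp only [orderFive]
  · linear_combination -h / 2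
  · ring
  · ring
  · ring

/-- Left multiplication by `2 * orderFive`, in coordinates of the form `a + b τ`. -/
def orderFiveMul (v : Fin 4 → ℤ × ℤ) : Fin 4 → ℤ × ℤ :=
  ![-goldenMul (v 0) - v 1 - (goldenMul (v 2) - v 2),
    -goldenMul (v 1) + v 0 + (goldenMul (v 3) - v 3),
    -goldenMul (v 2) - v 3 + (goldenMul (v 0) - v 0),
    -goldenMul (v 3) + v 2 - (goldenMul (v 1) - v 1)]

/-- The 120 directions form the binary icosahedral group, and `orderFive` is one of them, so left
multiplication permutes them. Codes stand for doubles, and the product of two doubles is four times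
a direction; hence `w i + w i`. The Booleans run over the signs of the coordinates. -/
lemma orderFiveMul_mem : ∀ v ∈ sideCodes, ∀ a b c d : Bool,
    ∃ w ∈ sideCodes, ∀ i, orderFiveMul ![bif a then v 0 else -v 0, bif b then v 1 else -v 1,
      bif c then v 2 else -v 2, bif d then v 3 else -v 3] i = w i + w i ∨
      orderFiveMul ![bif a then v 0 else -v 0, bif b then v 1 else -v 1,
      bif c then v 2 else -v 2, bif d then v 3 else -v 3] i = -(w i + w i) := by
  decide +kernel

lemma exists_toQuat_eq_orderFive_mul {u : Fin 4 → ℝ} (hu : u ∈ sideDirections) :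
    ∃ u' ∈ sideDirections, toQuat u' = orderFive * toQuat u := by
  obtain ⟨v, hv, ε, h⟩ := mem_sideDirections_iff.mp hu
  obtain ⟨b, hb⟩ : ∃ b : Fin 4 → Bool, ∀ i,
      2 * u i = goldenVal (bif b i then v i else -v i) := by
    refine ⟨fun i => decide (ε i = 1), fun i => ?_⟩
    rw [h i]
    rcases Int.units_eq_one_or (ε i) with e | e
    · simp [e]
    · have : (-1 : ℤˣ) ≠ 1 := by decide
      simp [e, this, goldenVal_neg]
  obtain ⟨w, hw, hwi⟩ := orderFiveMul_mem v hv (b 0) (b 1) (b 2) (b 3)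
  obtain ⟨x, hx⟩ : ∃ x : Fin 4 → ℤ × ℤ, x = ![bif b 0 then v 0 else -v 0,
    bif b 1 then v 1 else -v 1, bif b 2 then v 2 else -v 2, bif b 3 then v 3 else -v 3] := ⟨_, rfl⟩
  have hux : ∀ i, goldenVal (x i) = 2 * u i := by
    intro i
    rw [hb i, hx]
    fin_cases i <;> rfl
  rw [← hx] at hwi
  choose δ hδ using show ∀ i, ∃ δ : ℤˣ,
      goldenVal (orderFiveMul x i) = 2 * (((δ : ℤ) : ℝ) * goldenVal (w i)) by
    intro i
    rcases hwi i with e | e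
    · exact ⟨1, by rw [e, goldenVal_add]; simp; ring⟩
    · exact ⟨-1, by rw [e, goldenVal_neg, goldenVal_add]; simp; ring⟩
  have hmul : ∀ i, goldenVal (orderFiveMul x i) =
      2 * (2 * ![(orderFive * toQuat u).re, (orderFive * toQuat u).imI,
        (orderFive * toQuat u).imJ, (orderFive * toQuat u).imK] i) := by
    intro i
    fin_cases i <;>
      simp [orderFiveMul, sub_eq_add_neg, goldenVal_add, goldenVal_neg, goldenVal_goldenMul, hux] <;>
      simp only [orderFive] <;> ring
  refine ⟨![(orderFive * toQuat u).re, (orderFive * toQuat u).imI,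
    (orderFive * toQuat u).imJ, (orderFive * toQuat u).imK], ?_, rfl⟩
  refine mem_sideDirections_iff.mpr ⟨w, hw, δ, fun i => ?_⟩
  linarith [hmul i, hδ i]

/-- The lift of the symmetry of the 120-cell that multiplies the directions of the sides by
`orderFive`. -/
def symmetryLift : SU11H := diagUnit orderFive 1 normSq_orderFive (by simp)

/-- The relation `c² = -τ c - 1` for `c = orderFive` gives `c⁴ = -c - τ`, hence `c⁵ = -c² - τ c =
1`. -/
lemma symmetryLift_pow_five : symmetryLift ^ 5 = 1 := by
  have hφ := Real.goldenRatio_sq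
  have h2 := orderFive_mul_self
  have h3 : orderFive ^ 5 = 1 := by
    have h4 : orderFive ^ 4 = -orderFive - (Real.goldenRatio : ℝ) • 1 := by
      rw [show orderFive ^ 4 = (orderFive * orderFive) * (orderFive * orderFive) by
        simp only [pow_succ, pow_zero, one_mul, mul_assoc], h2]
      simp only [sub_mul, mul_sub, smul_mul_assoc, mul_smul_comm, h2, mul_one, one_mul]
      match_scalars
      · linear_combination (-Real.goldenRatio - 1) * hφ
      · linear_combination -hφ
    rw [pow_succ, h4, sub_mul, neg_mul, h2, smul_mul_assoc, one_mul]
    module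
  apply SU11H_ext
  change symmetryLift.val.val ^ 5 = 1
  have h5 : !![orderFive, 0; 0, 1] = Matrix.diagonal ![orderFive, 1] := by
    ext1 i j
    fin_cases i <;> fin_cases j <;> simp
  rw [symmetryLift, diagUnit_val, h5, Matrix.diagonal_pow]
  ext1 i j
  fin_cases i <;> fin_cases j <;> simp [h3]

lemma diagUnit_mul_translationLift (p w q : ℍ[ℝ]) (hp : Quaternion.normSq p = 1)
    (hw : Quaternion.normSq w = 1) :
    (diagUnit p w hp hw).val.val * translationLift q
      = translationLift (p * q * star w) * (diagUnit p w hp hw).val.val := by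
  have hp' : star p * p = 1 := by rw [Quaternion.star_mul_self, hp]; simp
  have hw' : star w * w = 1 := by rw [Quaternion.star_mul_self, hw]; simp
  rw [diagUnit_val, translationLift, translationLift, Matrix.mul_fin_two, Matrix.mul_fin_two]
  simp only [mul_zero, zero_mul, add_zero, zero_add, Quaternion.coe_commutes, star_mul, star_star,
    smul_mul_assoc, mul_smul_comm, mul_assoc, hp', hw', mul_one, smul_zero, add_zero, zero_add]

/-- The hypotheses on `Z` give `Z⁵ = 1` and `t = -(Z + Z⁴)`, and then `X² + t² (Z + 1) X + Z = (X -
Z²)(X - Z⁴)` divides `X⁵ - 1`. The proof reduces successive powers of `M` to combinations of `1`,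
`Z`, `M` and `Z * M`. -/
lemma pow_five_eq_one_of_quadratic {R : Type*} [Ring R] [Algebra ℝ R] {M Z : R} {t : ℝ}
    (ht : t ^ 2 = t + 1) (hZ : Z * Z = -t • Z - 1) (hc : M * Z = Z * M)
    (hM : M * M = -t ^ 2 • (Z * M) - t ^ 2 • M - Z) : M ^ 5 = 1 := by
  have hMZM : M * (Z * M) = t • (Z * M) + t ^ 2 • M + t • Z + 1 := by
    rw [← mul_assoc, hc, mul_assoc, hM]
    simp only [mul_sub, mul_smul_comm, ← mul_assoc, hZ, sub_mul, smul_mul_assoc, one_mul]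
    match_scalars
    · linear_combination t * ht
    · ring
    · ring
    · ring
  have h3 : M ^ 3 = t • (Z * M) - t • Z - t ^ 2 • 1 := by
    rw [show M ^ 3 = M * (M * M) by simp only [pow_succ, pow_zero, one_mul, mul_assoc], hM]
    simp only [mul_sub, mul_smul_comm, hMZM, hM, hc]
    match_scalars
    · linear_combination (t ^ 2 + 1) * ht
    · ring
    · linear_combination -t * ht
    · ring
  have h4 : M ^ 4 = Z * M + t • M + t ^ 2 • Z + t • 1 := by
    rw [pow_succ', h3]
    simp only [mul_sub, mul_smul_comm, hMZM, hc, mul_one]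
    match_scalars
    · linear_combination ht
    · linear_combination t * ht
    · ring
    · ring
  rw [pow_succ', h4]
  simp only [mul_add, mul_smul_comm, hMZM, hM, hc, mul_one]
  match_scalars
  · linear_combination -t * ht
  · linear_combination -t * ht
  · ring
  · ring

/-- All entries of `M = A * symmetryLift` lie in the commutative algebra `ℝ[c]`, where `c =
orderFive`. Its trace is `-τ² (1 + c)` and its determinant is `(cosh² r - sinh² r) c = c`, so
Cayley–Hamilton is the quadratic relation required by `pow_five_eq_one_of_quadratic`. -/
lemma translationLift_one_mul_pow_five {A : SU11H} (hA : A.val.val = translationLift 1) :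
    (A * symmetryLift) ^ 5 = 1 := by
  have hφ := Real.goldenRatio_sq
  have hS := sinh_inradius_sq
  have hC := cosh_inradius
  have h2 := orderFive_mul_self
  apply SU11H_ext
  change (A.val.val * symmetryLift.val.val) ^ 5 = 1
  have hM : A.val.val * symmetryLift.val.val
      = !![-Real.goldenRatio ^ 2 • orderFive, -Real.sinh inradius • 1;
        -Real.sinh inradius • orderFive, -Real.goldenRatio ^ 2 • 1] := by
    rw [hA, symmetryLift, diagUnit_val, translationLift, Matrix.mul_fin_two, hC]
    have h1 (r : ℝ) : (r : ℍ[ℝ]) = r • 1 := by rw [← Quaternion.coe_mul_eq_smul, mul_one]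
    simp only [h1, star_one, smul_mul_assoc, one_mul, mul_one, mul_zero, add_zero, zero_add]
  rw [hM]
  generalize Real.goldenRatio = t at *
  generalize Real.sinh inradius = S at *
  generalize orderFive = c at *
  refine pow_five_eq_one_of_quadratic (Z := !![c, 0; 0, c]) hφ ?_ ?_ ?_
  · rw [Matrix.mul_fin_two]
    ext1 i j
    fin_cases i <;> fin_cases j <;> simp [h2]
  · rw [Matrix.mul_fin_two, Matrix.mul_fin_two]
    simp
  · simp only [Matrix.mul_fin_two]
    ext1 i j
    fin_cases i <;> fin_cases j <;>
      simp [h2, smul_sub, smul_smul, -neg_smul]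
    · match_scalars
      · linear_combination hS - (t ^ 2 + t + 2) * hφ
      · ring
    · match_scalars
      · ring
      · ring
    · match_scalars
      · ring
      · ring
    · match_scalars
      · linear_combination hS - (t ^ 2 + t + 2) * hφ
      · ring

/-- Conjugation by `diag(1, q)` moves the direction `q` to `1` and commutes with `symmetryLift`,
which reduces the claim to the direction `1`. -/
lemma mul_symmetryLift_pow_five {A : SU11H} {q : ℍ[ℝ]} (hq : Quaternion.normSq q = 1)
    (hA : A.val.val = translationLift q) : (A * symmetryLift) ^ 5 = 1 := by
  let E := diagUnit 1 q (by simp) hq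
  have h1 : (E * A * E⁻¹).val.val = translationLift 1 := by
    change E.val.val * A.val.val * (E⁻¹).val.val = _
    rw [hA, diagUnit_mul_translationLift, one_mul, Quaternion.self_mul_star, hq, mul_assoc]
    change _ * (E * E⁻¹).val.val = _
    rw [mul_inv_cancel]
    exact mul_one _
  have h2 : E * symmetryLift = symmetryLift * E := by
    apply SU11H_ext
    change !![1, 0; 0, q] * !![orderFive, 0; 0, 1] = !![orderFive, 0; 0, 1] * !![1, 0; 0, q]
    simp
  have h3 := translationLift_one_mul_pow_five h1
  have h4 : E * A * E⁻¹ * symmetryLift = E * (A * symmetryLift) * E⁻¹ := by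
    simp only [mul_assoc]
    congr 2
    rw [eq_mul_inv_iff_mul_eq, mul_assoc, ← h2, inv_mul_cancel_left]
  rw [h4, conj_pow, mul_inv_eq_one] at h3
  exact mul_eq_left.mp h3

/-! ### Existence and uniqueness of the fully symmetric lift -/

/-- The lift of the Davis group that is contained in the congruence subgroup. -/
def davisLift : Subgroup SU11H :=
  Subgroup.closure {A | ∃ u ∈ sideDirections, A.val.val = translationLift (toQuat u)}

lemma davisLift_map_eta : davisLift.map eta = davisGroup := by
  rw [davisLift, davisGroup, MonoidHom.map_closure]
  congr 1
  ext g
  constructor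
  · rintro ⟨A, ⟨u, hu, hA⟩, rfl⟩
    obtain ⟨B, hB, hB'⟩ := exists_eta_translationLift u (sideDirections_norm hu)
    rw [SU11H_ext (hA.trans hB.symm)]
    exact ⟨u, hu, hB'⟩
  · rintro ⟨u, hu, hg⟩
    obtain ⟨B, hB, hB'⟩ := exists_eta_translationLift u (sideDirections_norm hu)
    exact ⟨B, ⟨u, hu, hB⟩, Subtype.ext (Units.ext (hB'.trans hg.symm))⟩

/-- The sign in `translationLift` is chosen for this: `-τ² - 1 = (1 - τ) sinh² r`. Off the diagonal,
the directions have half-integral coordinates over `ℤ[τ]`, which is why `2` is inverted. -/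
lemma davisLift_le_congruenceSubgroup : davisLift ≤ congruenceSubgroup := by
  rw [davisLift, Subgroup.closure_le]
  rintro A ⟨u, hu, hA⟩
  have hS : ∀ i, -(Real.sinh inradius * u i) ∈ sinhMultiples := fun i =>
    neg_mem ⟨1, _, isIntegral_two_mul_of_mem hu i, by ring⟩
  have hC : -Real.goldenRatio ^ 2 - 1 ∈ sinhMultiples := by
    refine ⟨0, Real.sinh inradius * (1 - Real.goldenRatio),
      isIntegral_sinh_inradius.mul (isIntegral_one.sub isIntegral_goldenRatio), ?_⟩
    linear_combination (Real.goldenRatio - 1) * sinh_inradius_sq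
      + 2 * Real.goldenRatio_sq
  have hd : ((-Real.cosh inradius : ℝ) : ℍ[ℝ]) - 1 ∈ quatSinhMultiples := by
    rw [cosh_inradius]
    refine ⟨?_, ?_, ?_, ?_⟩
    · simpa only [Quaternion.re_sub, Quaternion.re_coe, Quaternion.re_one] using hC
    · simp only [Quaternion.imI_sub, Quaternion.imI_coe, Quaternion.imI_one, sub_zero, zero_mem]
    · simp only [Quaternion.imJ_sub, Quaternion.imJ_coe, Quaternion.imJ_one, sub_zero, zero_mem]
    · simp only [Quaternion.imK_sub, Quaternion.imK_coe, Quaternion.imK_one, sub_zero, zero_mem]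
  have ho : -Real.sinh inradius • toQuat u ∈ quatSinhMultiples := by
    refine ⟨?_, ?_, ?_, ?_⟩
    · simpa using hS 0
    · simpa using hS 1
    · simpa using hS 2
    · simpa using hS 3
  have ho' : -Real.sinh inradius • star (toQuat u) ∈ quatSinhMultiples := by
    simpa using star_mem_quatSinhMultiples ho
  intro i j
  rw [hA, translationLift, Matrix.sub_apply]
  fin_cases i <;> fin_cases j
  · exact hd
  · simpa using ho
  · simpa using ho'
  · exact hd

/-- The spin structure given by the lift of the Davis group in the congruence subgroup. -/
def davisSpinStructure : SpinStructure davisGroup where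
  lift := davisLift
  bijOn := by
    refine ⟨fun A hA => ?_, fun A hA B hB h => ?_, fun g hg => ?_⟩
    · rw [← davisLift_map_eta]
      exact ⟨A, hA, rfl⟩
    · rcases eq_or_eq_negOne_mul_of_eta_eq h with h | h
      · exact h
      · exact absurd (by rw [h, reTrace_negOne_mul]) (reTrace_ne_neg_reTrace
          (davisLift_le_congruenceSubgroup hA) (davisLift_le_congruenceSubgroup hB))
    · rw [← davisLift_map_eta] at hg
      exact hg

/-- A conjugate of `b` over the normalizer equals `c` or `-c` for some `c` in `davisLift`. The
second case would give `b` and `c` opposite traces. -/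
lemma davisSpinStructure_isFullySymmetric : davisSpinStructure.IsFullySymmetric := by
  apply SpinStructure.isFullySymmetric_of_forall
  have key : ∀ a : SU11H, eta a ∈ Subgroup.normalizer (davisGroup : Set SOPlus) →
      ∀ b ∈ davisLift, a * b * a⁻¹ ∈ davisLift := by
    intro a ha b hb
    have h1 : eta (a * b * a⁻¹) ∈ davisGroup := by
      rw [map_mul, map_mul, map_inv]
      exact (Subgroup.mem_normalizer_iff.mp ha _).mp (davisSpinStructure.bijOn.mapsTo hb)
    obtain ⟨c, hc, e⟩ := davisSpinStructure.bijOn.surjOn h1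
    rcases eq_or_eq_negOne_mul_of_eta_eq e.symm with h | h
    · rw [h]; exact hc
    · refine absurd ?_ (reTrace_ne_neg_reTrace (davisLift_le_congruenceSubgroup hb)
        (davisLift_le_congruenceSubgroup hc))
      rw [← reTrace_negOne_mul, ← h, reTrace_mul_comm, inv_mul_cancel_left]
  intro a ha
  refine Subgroup.mem_normalizer_iff.mpr fun b => ⟨key a ha b, fun hb => ?_⟩
  have h := key a⁻¹ (by rw [map_inv]; exact inv_mem ha) _ hb
  change b ∈ davisLift
  simpa [mul_assoc] using h

lemma symmetryLift_mem_normalizer : symmetryLift ∈ Subgroup.normalizer (davisLift : Set SU11H) := by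
  have key : ∀ b ∈ davisLift, symmetryLift * b * symmetryLift⁻¹ ∈ davisLift := by
    have hle : davisLift ≤ davisLift.comap (MulAut.conj symmetryLift).toMonoidHom := by
      conv_lhs => rw [davisLift]
      rw [Subgroup.closure_le]
      rintro A ⟨u, hu, hA⟩
      obtain ⟨u', hu', e⟩ := exists_toQuat_eq_orderFive_mul hu
      refine Subgroup.subset_closure ⟨u', hu', ?_⟩
      have h : symmetryLift.val.val * A.val.val
          = translationLift (toQuat u') * symmetryLift.val.val := by
        rw [hA, e, symmetryLift, diagUnit_mul_translationLift, star_one, mul_one]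
      change symmetryLift.val.val * A.val.val * (symmetryLift⁻¹).val.val = _
      rw [h, mul_assoc]
      change _ * (symmetryLift * symmetryLift⁻¹).val.val = _
      rw [mul_inv_cancel]
      exact mul_one _
    exact fun b hb => hle hb
  refine Subgroup.mem_normalizer_iff.mpr fun b => ⟨key b, fun hb => ?_⟩
  -- The reverse inclusion uses that the fourth power of `symmetryLift` is its inverse: four further
  -- conjugations bring back `b`.
  have h := key _ (key _ (key _ (key _ hb)))
  have e : symmetryLift * (symmetryLift * (symmetryLift * (symmetryLift *
      (symmetryLift * b * symmetryLift⁻¹) * symmetryLift⁻¹) * symmetryLift⁻¹) * symmetryLift⁻¹)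
      * symmetryLift⁻¹ = symmetryLift ^ 5 * b * (symmetryLift ^ 5)⁻¹ := by
    simp only [pow_succ, pow_zero, one_mul, mul_inv_rev, mul_assoc]
  rw [e, symmetryLift_pow_five] at h
  simpa using h

lemma eta_symmetryLift_mem_normalizer :
    eta symmetryLift ∈ Subgroup.normalizer (davisGroup : Set SOPlus) := by
  have h := Subgroup.mem_normalizer_iff_map_conj_eq.mp symmetryLift_mem_normalizer
  rw [Subgroup.mem_normalizer_iff_map_conj_eq, ← davisLift_map_eta]
  conv_rhs => rw [← h]
  rw [Subgroup.map_map, Subgroup.map_map]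
  congr 1
  ext1 a
  simp

/-- The lift of the Davis group in a fully symmetric spin structure contains the lifts, in the
congruence subgroup, of the translations that generate the Davis group. -/
lemma SpinStructure.IsFullySymmetric.davisLift_le {S : SpinStructure davisGroup}
    (hS : S.IsFullySymmetric) : davisLift ≤ S.lift := by
  have hD := hS.mem_normalizer eta_symmetryLift_mem_normalizer
  rw [davisLift, Subgroup.closure_le]
  rintro A ⟨u, hu, hA⟩
  have hAΓ : eta A ∈ davisGroup := by
    rw [← davisLift_map_eta]
    exact ⟨A, Subgroup.subset_closure ⟨u, hu, hA⟩, rfl⟩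
  obtain ⟨B, hB, e⟩ := S.bijOn.surjOn hAΓ
  rcases eq_or_eq_negOne_mul_of_eta_eq e with rfl | rfl
  · exact hB
  · exfalso
    have h5 : (A * symmetryLift) ^ 5 = 1 := mul_symmetryLift_pow_five
      (by simpa [Quaternion.normSq_def'] using sideDirections_norm hu) hA
    have h1 : negOne * negOne = 1 := by
      apply SU11H_ext
      rw [negOne_mul_val, negOne_val, neg_neg]
      rfl
    have conj : ∀ b ∈ S.lift, symmetryLift * b * symmetryLift⁻¹ ∈ S.lift := fun b =>
      (Subgroup.mem_normalizer_iff.mp hD b).mp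
    -- With `s = symmetryLift` and `B = -A`, the telescoping product of `s^i B s^(-i)` for `i = 0,
    -- ..., 4` is `(B s)^5 s^(-5)`.
    have h2 : ((negOne * A) * symmetryLift) ^ 5 * (symmetryLift ^ 5)⁻¹ ∈ S.lift := by
      have c1 := conj _ hB
      have c2 := conj _ c1
      have c3 := conj _ c2
      have c4 := conj _ c3
      have := mul_mem (mul_mem (mul_mem (mul_mem hB c1) c2) c3) c4
      convert this using 1
      generalize negOne * A = B
      simp only [pow_succ, pow_zero, one_mul, mul_inv_rev, mul_assoc, inv_mul_cancel_left,
        mul_inv_cancel_left]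
    -- The exponent is odd, so the central sign survives.
    have h3 : ((negOne * A) * symmetryLift) ^ 5 = negOne := by
      have hc : Commute negOne (A * symmetryLift) := negOne_mul_comm _
      rw [mul_assoc, hc.mul_pow, h5, mul_one]
      simp only [pow_succ, pow_zero, one_mul, h1]
    rw [h3, symmetryLift_pow_five, inv_one, mul_one] at h2
    have h4 : negOne = 1 := S.bijOn.injOn h2 (one_mem S.lift) (by
      have := eta_negOne_mul 1
      rwa [mul_one] at this)
    have h6 := congrArg reTrace h4
    have h7 : reTrace 1 = 2 := by
      change ((1 : Matrix (Fin 2) (Fin 2) ℍ[ℝ]) 0 0).re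
        + ((1 : Matrix (Fin 2) (Fin 2) ℍ[ℝ]) 1 1).re = 2
      norm_num
    rw [← mul_one negOne, reTrace_negOne_mul, h7] at h6
    norm_num at h6

end Davis

end

theorem theorem3p2 :
    ∃! S : Davis.SpinStructure Davis.davisGroup, S.IsFullySymmetric := by
  refine ⟨Davis.davisSpinStructure, Davis.davisSpinStructure_isFullySymmetric, fun S hS => ?_⟩
  refine Davis.SpinStructure.ext (le_antisymm (fun a ha => ?_) hS.davisLift_le)
  -- Both lifts map bijectively onto the Davis group, so an inclusion between them is an equality.
  obtain ⟨b, hb, e⟩ := Davis.davisSpinStructure.bijOn.surjOn (S.bijOn.mapsTo ha)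
  rwa [← S.bijOn.injOn (hS.davisLift_le hb) ha e]
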